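/- \textbf{Theorem.} Let $G$ be a countable abelian group, let $P\subseteq G$ be a subsemigroup containing the identity, and let $d:P\to\mathbb{N}^*$ be a semigroup homomorphism into the multiplicative semigroup of positive integers. Let $E=E(d)$ be the lexicographic product system determined by $d$, that is, $E=\bigsqcup_{s\in P}\{s\}\times\mathbb{C}^{d(s)}$ with the bilinear multiplication given on the canonical basis vectors by $$(r,\delta_j)(s,\delta_k)=(rs,\delta_{j\,d(s)+k}),\qquad 0\le j<d(r),\ 0\le k<d(s).$$ A Cuntz representation of $E$ in a $C^*$-algebra $B$ is a multiplicative map $\phi:E\to B$ such that $\phi(y)^*\phi(x)=(x\mid y)\,\phi(1)$ whenever $x,y$ lie in the same fiber, where $1$ is the identity of $E$ and $(\cdot\mid\cdot)$ is linear in the first variable, and such that $\sum_{f\in\mathcal{B}}\phi(f)\phi(f)^*=\phi(1)$ for every orthonormal basis $\mathcal{B}$ of every fiber. Let $\mathcal{O}_E$ be the universal $C^*$-algebra for Cuntz representations of $E$: it is generated by the range of a Cuntz representation $i_E:E\to\mathcal{O}_E$, and every Cuntz representation $\phi$ of $E$ in a $C^*$-algebra $B$ is of the form $\phi=\phi_*\circ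 i_E$ for a $*$-homomorphism $\phi_*:\mathcal{O}_E\to B$. Then $\mathcal{O}_E$ is simple (that is, nonzero and without closed two-sided ideals other than $0$ and $\mathcal{O}_E$) if and only if $d$ is injective. -/

import Mathlib

open scoped ENNReal InnerProductSpace

universe u v w

noncomputable section

/-- A product system of finite-dimensional Hilbert spaces over a discrete monoid `P`: a family of
complex Hilbert spaces `fiber s`, `s : P`, with an associative multiplication
`fiber s × fiber t → fiber (s * t)` on the total space such that `x ⊗ y ↦ x y` extends to a unitary
`fiber s ⊗ fiber t → fiber (s * t)` (a bilinear map that multiplies inner products and whose values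
span), with one-dimensional fiber over the identity, and with an identity element `one` of the
total space (such an element is unique). -/
structure ProductSystem (P : Type u) [Monoid P] where
  fiber : P → Type v
  [normedAddCommGroup : ∀ s, NormedAddCommGroup (fiber s)]
  [innerProductSpace : ∀ s, InnerProductSpace ℂ (fiber s)]
  [finiteDimensional : ∀ s, FiniteDimensional ℂ (fiber s)]
  [nontrivial : ∀ s, Nontrivial (fiber s)]
  mul : ∀ {s t : P}, fiber s →ₗ[ℂ] fiber t →ₗ[ℂ] fiber (s * t)
  mul_assoc : ∀ {r s t : P} (x : fiber r) (y : fiber s) (z : fiber t),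
    (⟨r * s * t, mul (mul x y) z⟩ : Σ p, fiber p) = ⟨r * (s * t), mul x (mul y z)⟩
  inner_mul : ∀ {s t : P} (x x' : fiber s) (y y' : fiber t),
    ⟪mul x y, mul x' y'⟫_ℂ = ⟪x, x'⟫_ℂ * ⟪y, y'⟫_ℂ
  span_mul : ∀ s t : P,
    Submodule.span ℂ {z : fiber (s * t) | ∃ (x : fiber s) (y : fiber t), mul x y = z} = ⊤
  finrank_fiber_one : Module.finrank ℂ (fiber 1) = 1
  one : fiber 1
  one_mul : ∀ {s : P} (x : fiber s), (⟨1 * s, mul one x⟩ : Σ p, fiber p) = ⟨s, x⟩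
  mul_one : ∀ {s : P} (x : fiber s), (⟨s * 1, mul x one⟩ : Σ p, fiber p) = ⟨s, x⟩

attribute [instance] ProductSystem.normedAddCommGroup ProductSystem.innerProductSpace
  ProductSystem.finiteDimensional ProductSystem.nontrivial

namespace ProductSystem

variable {P : Type u} [Monoid P]

/-- A representation of the product system `E` in the C⋆-algebra `B`: a multiplicative map on the
total space with `φ(y)* φ(x) = (x ∣ y) φ(1)` for `x`, `y` in the same fiber, where `(x ∣ y)` is
linear in `x` (hence is written `⟪y, x⟫_ℂ` here). Linearity on fibers is a consequence. -/
structure Representation (E : ProductSystem.{u, v} P) (B : Type w) [NonUnitalCStarAlgebra B] where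
  toFun : ∀ {s : P}, E.fiber s → B
  map_mul : ∀ {s t : P} (x : E.fiber s) (y : E.fiber t), toFun (E.mul x y) = toFun x * toFun y
  star_mul : ∀ {s : P} (x y : E.fiber s), star (toFun y) * toFun x = ⟪y, x⟫_ℂ • toFun E.one

/-- A Cuntz representation: `∑ f, φ(f) φ(f)* = φ(1)` for every orthonormal basis of every fiber. -/
structure CuntzRep (E : ProductSystem.{u, v} P) (B : Type w) [NonUnitalCStarAlgebra B]
    extends Representation E B where
  sum_mul_star : ∀ (s : P) (n : ℕ) (b : OrthonormalBasis (Fin n) ℂ (E.fiber s)),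
    ∑ i, toFun (b i) * star (toFun (b i)) = toFun E.one

variable (E : ProductSystem.{u, v} P)

lemma norm_one : ‖E.one‖ = 1 := by
  have h1 : ‖E.mul E.one E.one‖ = ‖E.one‖ :=
    congrArg (fun z : (Σ p, E.fiber p) => ‖z.2‖) (E.one_mul E.one)
  have h2 : ‖E.mul E.one E.one‖ ^ 2 = ‖E.one‖ ^ 2 * ‖E.one‖ ^ 2 := by
    have h := E.inner_mul E.one E.one E.one E.one
    simp only [inner_self_eq_norm_sq_to_K] at h
    exact_mod_cast h
  have h0 : E.one ≠ 0 := by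
    intro h
    obtain ⟨x, hx⟩ := exists_ne (0 : E.fiber 1)
    have h3 : ‖E.mul E.one x‖ = ‖x‖ :=
      congrArg (fun z : (Σ p, E.fiber p) => ‖z.2‖) (E.one_mul x)
    rw [h] at h3
    rw [map_zero, LinearMap.zero_apply, _root_.norm_zero] at h3
    exact hx (norm_eq_zero.mp h3.symm)
  have h4 : ‖E.one‖ ≠ 0 := norm_ne_zero_iff.mpr h0
  rw [h1] at h2
  have h5 : ‖E.one‖ ^ 2 = 1 := by
    have : ‖E.one‖ ^ 2 ≠ 0 := pow_ne_zero _ h4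
    exact mul_left_cancel₀ this (by linarith)
  nlinarith [norm_nonneg E.one]

section

variable {E} {B : Type w} [NonUnitalCStarAlgebra B]

lemma Representation.norm_le (φ : Representation E B) {s : P} (x : E.fiber s) :
    ‖φ.toFun x‖ ≤ ‖x‖ := by
  have h1 : star (φ.toFun E.one) * φ.toFun E.one = φ.toFun E.one := by
    rw [φ.star_mul, inner_self_eq_norm_sq_to_K, E.norm_one]; simp
  have h2 : ‖φ.toFun E.one‖ * ‖φ.toFun E.one‖ = ‖φ.toFun E.one‖ := by
    rw [← CStarRing.norm_star_mul_self, h1]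
  have h3 : ‖φ.toFun E.one‖ ≤ 1 := by nlinarith [norm_nonneg (φ.toFun E.one)]
  have h4 : ‖φ.toFun x‖ * ‖φ.toFun x‖ = ‖x‖ ^ 2 * ‖φ.toFun E.one‖ := by
    rw [← CStarRing.norm_star_mul_self, φ.star_mul, norm_smul, inner_self_eq_norm_sq_to_K]
    simp
  have h5 : ‖φ.toFun x‖ ^ 2 ≤ ‖x‖ ^ 2 := by
    nlinarith [sq_nonneg ‖x‖]
  exact (sq_le_sq₀ (norm_nonneg _) (norm_nonneg _)).mp h5

lemma Representation.norm_sub_le (φ : Representation E B) {s : P} (x y : E.fiber s) :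
    ‖φ.toFun x - φ.toFun y‖ ≤ ‖x - y‖ := by
  have h : star (φ.toFun x - φ.toFun y) * (φ.toFun x - φ.toFun y)
      = star (φ.toFun (x - y)) * φ.toFun (x - y) := by
    simp only [star_sub, sub_mul, mul_sub, φ.star_mul, inner_sub_left, inner_sub_right, sub_smul]
  have h2 : ‖φ.toFun x - φ.toFun y‖ ^ 2 = ‖φ.toFun (x - y)‖ ^ 2 := by
    rw [sq, sq, ← CStarRing.norm_star_mul_self, h, CStarRing.norm_star_mul_self]
  have h3 := (sq_eq_sq₀ (norm_nonneg _) (norm_nonneg _)).mp h2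
  rw [h3]
  exact φ.norm_le _

lemma Representation.continuous (φ : Representation E B) (s : P) :
    Continuous (fun x : E.fiber s => φ.toFun x) := by
  refine (LipschitzWith.of_dist_le_mul (K := 1) fun x y => ?_).continuous
  simpa [dist_eq_norm] using φ.norm_sub_le x y

/-- The composition of a Cuntz representation with a ⋆-homomorphism. -/
def CuntzRep.comp (φ : CuntzRep E B) {C : Type*} [NonUnitalCStarAlgebra C] (π : B →⋆ₙₐ[ℂ] C) :
    CuntzRep E C where
  toFun x := π (φ.toFun x)
  map_mul x y := by rw [φ.map_mul, _root_.map_mul]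
  star_mul x y := by rw [← map_star, ← _root_.map_mul, φ.star_mul, map_smul]
  sum_mul_star s n b := by
    rw [← φ.sum_mul_star s n b, map_sum]
    simp only [_root_.map_mul, map_star]

/-- A Cuntz representation whose values lie in a closed ⋆-subalgebra, as one in the latter. -/
def CuntzRep.codRestrict (φ : CuntzRep E B) (S : NonUnitalStarSubalgebra ℂ B)
    [IsClosed (S : Set B)] (h : ∀ (s : P) (x : E.fiber s), φ.toFun x ∈ S) : CuntzRep E S where
  toFun {s} x := ⟨φ.toFun x, h s x⟩
  map_mul x y := Subtype.ext (φ.map_mul x y)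
  star_mul x y := Subtype.ext (φ.star_mul x y)
  sum_mul_star s n b := by
    apply Subtype.ext
    rw [AddSubmonoidClass.coe_finsetSum]
    exact φ.sum_mul_star s n b

/-- The C⋆-subalgebra generated by the range of a Cuntz representation. -/
def CuntzRep.cstar (φ : CuntzRep E B) : NonUnitalStarSubalgebra ℂ B :=
  (NonUnitalStarAlgebra.adjoin ℂ {b : B | ∃ (s : P) (x : E.fiber s), φ.toFun x = b}).topologicalClosure

instance (φ : CuntzRep E B) : IsClosed (φ.cstar : Set B) :=
  NonUnitalStarSubalgebra.isClosed_topologicalClosure _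

lemma CuntzRep.mem_cstar (φ : CuntzRep E B) (s : P) (x : E.fiber s) : φ.toFun x ∈ φ.cstar :=
  NonUnitalStarSubalgebra.le_topologicalClosure _
    (NonUnitalStarAlgebra.subset_adjoin ℂ _ ⟨s, x, rfl⟩)

end

/-- A Cuntz representation of `E` together with its target C⋆-algebra. -/
structure BundledCuntzRep where
  carrier : Type
  [cstarAlgebra : NonUnitalCStarAlgebra carrier]
  rep : CuntzRep E carrier

attribute [instance] BundledCuntzRep.cstarAlgebra

/-- The direct sum of all Cuntz representations of `E` in C⋆-algebras with carrier in `Type`. (As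
`P` is countable, every Cuntz representation generates a separable C⋆-algebra, which has a copy with
carrier in `Type`.) -/
def sumRep : CuntzRep E (lp (fun i : BundledCuntzRep E => i.carrier) ∞) where
  toFun x := ⟨fun i => i.rep.toFun x, memℓp_infty ⟨‖x‖, by
    rintro _ ⟨i, rfl⟩
    exact i.rep.norm_le x⟩⟩
  map_mul x y := by
    ext i
    exact i.rep.map_mul x y
  star_mul x y := by
    ext i
    exact i.rep.star_mul x y
  sum_mul_star s n b := by
    ext i
    rw [lp.coeFn_sum, Finset.sum_apply]
    exact i.rep.sum_mul_star s n b

/-- The C⋆-algebra `𝒪_E` of `E`: the C⋆-algebra generated by the range of the direct sum of all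
Cuntz representations of `E`. See `CuntzAlgebra.existsUnique_lift` and `CuntzAlgebra.cstar_eq_top`
for the universal property, which determines it up to isomorphism. -/
abbrev CuntzAlgebra : Type (max 1 u v) := (sumRep E).cstar

/-- The universal Cuntz representation `i_E : E → 𝒪_E`. -/
def CuntzAlgebra.rep : CuntzRep E (CuntzAlgebra E) :=
  (sumRep E).codRestrict _ (sumRep E).mem_cstar

section

variable {E} {B : Type w} [NonUnitalCStarAlgebra B]

lemma exists_copy_of_separable (A : Type w) [NonUnitalCStarAlgebra A]
    [TopologicalSpace.SeparableSpace A] :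
    ∃ (A' : Type) (_ : NonUnitalCStarAlgebra A'), Nonempty (A' ≃⋆ₐ[ℂ] A) := by
  have hsmall : Small.{0} A := by
    refine small_of_injective (β := ℕ → ℝ)
      (f := fun a n => dist a (TopologicalSpace.denseSeq A n)) ?_
    intro a b hab
    have h : (fun c => dist a c) = fun c => dist b c :=
      (TopologicalSpace.denseRange_denseSeq A).equalizer
        (by fun_prop) (by fun_prop) hab
    have := congrFun h b
    simpa using this
  let e : Shrink.{0} A ≃ A := (equivShrink A).symm
  let i1 : NonUnitalRing (Shrink.{0} A) := e.nonUnitalRing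
  let i2 : Module ℂ (Shrink.{0} A) := e.module ℂ
  have eadd : ∀ x y, e (x + y) = e x + e y := fun x y => e.apply_symm_apply _
  have emul : ∀ x y, e (x * y) = e x * e y := fun x y => e.apply_symm_apply _
  have esmul : ∀ (c : ℂ) x, e (c • x) = c • e x := fun c x => e.apply_symm_apply _
  have ezero : e 0 = 0 := e.apply_symm_apply _
  let f : Shrink.{0} A →ₙ+* A :=
    { toFun := e, map_mul' := emul, map_zero' := ezero, map_add' := eadd }
  let i3 : NonUnitalNormedRing (Shrink.{0} A) :=
    NonUnitalNormedRing.induced (Shrink.{0} A) A f e.injective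
  have enorm : ∀ x : Shrink.{0} A, ‖x‖ = ‖e x‖ := fun x => rfl
  let i4 : StarRing (Shrink.{0} A) :=
    { star := fun x => e.symm (star (e x))
      star_involutive := fun x => by simp
      star_mul := fun x y => e.injective (by
        change e (e.symm (star (e (x * y)))) = e (e.symm (star (e y)) * e.symm (star (e x)))
        simp only [emul, Equiv.apply_symm_apply, StarMul.star_mul])
      star_add := fun x y => e.injective (by
        change e (e.symm (star (e (x + y)))) = e (e.symm (star (e x)) + e.symm (star (e y)))
        simp only [eadd, Equiv.apply_symm_apply, StarAddMonoid.star_add]) }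
  have estar : ∀ x : Shrink.{0} A, e (star x) = star (e x) := fun x => e.apply_symm_apply _
  have hiso : Isometry e := AddMonoidHomClass.isometry_of_norm f fun x => rfl
  let i5 : NonUnitalCStarAlgebra (Shrink.{0} A) :=
    { i3, i4, i2 with
      complete := by
        have : CompleteSpace (Shrink.{0} A) :=
          (completeSpace_congr (e := e) hiso.isUniformEmbedding).mpr inferInstance
        exact fun {F} hF => this.complete hF
      norm_mul_self_le := fun x => by
        rw [enorm, enorm, emul, estar]
        exact CStarRing.norm_mul_self_le _
      smul_assoc := fun c x y => e.injective (by
        simp only [smul_eq_mul, esmul, emul, smul_mul_assoc])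
      smul_comm := fun c x y => e.injective (by
        simp only [smul_eq_mul, esmul, emul, mul_smul_comm])
      norm_smul_le := fun c x => by
        rw [enorm, enorm, esmul]
        exact norm_smul_le _ _
      star_smul := fun c x => e.injective (by
        simp only [estar, esmul, StarModule.star_smul]) }
  exact ⟨Shrink.{0} A, i5, ⟨
    { e with
      map_mul' := emul
      map_add' := eadd
      map_smul' := esmul
      map_star' := estar }⟩⟩

lemma countable_subsemigroup_closure {A : Type*} [Semigroup A] {c : Set A} (hc : c.Countable) :
    (Subsemigroup.closure c : Set A).Countable := by
  have := hc.to_subtype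
  let g : c × List c → A := fun p => p.2.foldl (fun (a : A) (b : c) => a * (b : A)) p.1
  have hg : ∀ (m : List c) (x y : A), x * m.foldl (fun (a : A) (b : c) => a * (b : A)) y
      = m.foldl (fun (a : A) (b : c) => a * (b : A)) (x * y) := by
    intro m
    induction m with
    | nil => intro x y; rfl
    | cons z m ih => intro x y; simp only [List.foldl_cons, ih, _root_.mul_assoc]
  let S : Subsemigroup A :=
    { carrier := Set.range g
      mul_mem' := by
        rintro _ _ ⟨⟨a, l⟩, rfl⟩ ⟨⟨b, m⟩, rfl⟩
        refine ⟨⟨a, l ++ b :: m⟩, ?_⟩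
        simp only [g, List.foldl_append, List.foldl_cons, hg] }
  have hS : Subsemigroup.closure c ≤ S :=
    Subsemigroup.closure_le.mpr fun x hx => ⟨⟨⟨x, hx⟩, []⟩, rfl⟩
  exact (Set.countable_range g).mono hS

lemma CuntzRep.separable_cstar [Countable P] (φ : CuntzRep E B) :
    TopologicalSpace.SeparableSpace φ.cstar := by
  have h1 : TopologicalSpace.IsSeparable
      {b : B | ∃ (s : P) (x : E.fiber s), φ.toFun x = b} := by
    have : {b : B | ∃ (s : P) (x : E.fiber s), φ.toFun x = b}
        = ⋃ s : P, Set.range (fun x : E.fiber s => φ.toFun x) := by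
      ext b; simp
    rw [this]
    refine TopologicalSpace.IsSeparable.iUnion fun s => ?_
    have : ProperSpace (E.fiber s) := FiniteDimensional.proper ℂ _
    exact TopologicalSpace.isSeparable_range (φ.continuous s)
  obtain ⟨c, hc, hsub⟩ := h1
  have h2 : φ.cstar ≤ (NonUnitalStarAlgebra.adjoin ℂ c).topologicalClosure := by
    refine NonUnitalStarSubalgebra.topologicalClosure_minimal _
      (NonUnitalStarAlgebra.adjoin_le ?_) (NonUnitalStarSubalgebra.isClosed_topologicalClosure _)
    exact hsub.trans (closure_mono (NonUnitalStarAlgebra.subset_adjoin ℂ c))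
  have h3 : TopologicalSpace.IsSeparable (NonUnitalStarAlgebra.adjoin ℂ c : Set B) := by
    have h4 : (Subsemigroup.closure (c ∪ star c) : Set B).Countable :=
      countable_subsemigroup_closure (hc.union (by
        rw [← Set.image_star]
        exact hc.image _))
    have h5 : (NonUnitalStarAlgebra.adjoin ℂ c : Set B)
        = Submodule.span ℂ (Subsemigroup.closure (c ∪ star c) : Set B) := by
      rw [← NonUnitalStarAlgebra.adjoin_eq_span]
      rfl
    rw [h5]
    exact h4.isSeparable.span
  exact (TopologicalSpace.IsSeparable.mono h3.closure h2).separableSpace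

lemma CuntzRep.cstar_hom_ext (φ : CuntzRep E B) (hφ : φ.cstar = ⊤)
    {C : Type*} [NonUnitalCStarAlgebra C] (π ρ : B →⋆ₙₐ[ℂ] C)
    (h : ∀ (s : P) (x : E.fiber s), π (φ.toFun x) = ρ (φ.toFun x)) : π = ρ := by
  have cont : ∀ τ : B →⋆ₙₐ[ℂ] C, Continuous τ := fun τ =>
    AddMonoidHomClass.continuous_of_bound τ 1 fun b => by
      simpa using NonUnitalStarAlgHom.norm_apply_le τ b
  have hcl : IsClosed {b : B | π b = ρ b} :=
    isClosed_eq (cont π) (cont ρ)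
  have hle : φ.cstar ≤ NonUnitalStarAlgHom.equalizer π ρ := by
    refine NonUnitalStarSubalgebra.topologicalClosure_minimal _
      (NonUnitalStarAlgebra.adjoin_le ?_) hcl
    rintro _ ⟨s, x, rfl⟩
    exact h s x
  ext b
  exact hle (hφ ▸ NonUnitalStarAlgebra.mem_top)

end

/-- The range of `i_E` generates `𝒪_E` as a C⋆-algebra. -/
theorem CuntzAlgebra.cstar_eq_top : (CuntzAlgebra.rep E).cstar = ⊤ := by
  have hcl : IsClosed (Subtype.val '' ((CuntzAlgebra.rep E).cstar : Set (CuntzAlgebra E))) :=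
    (inferInstance : IsClosed ((sumRep E).cstar :
      Set (lp (fun i : BundledCuntzRep E => i.carrier) ∞))).isClosedEmbedding_subtypeVal.isClosedMap
      _ (NonUnitalStarSubalgebra.isClosed_topologicalClosure _)
  have hle : (sumRep E).cstar ≤ (CuntzAlgebra.rep E).cstar.map
      (NonUnitalStarSubalgebraClass.subtype (sumRep E).cstar) := by
    refine NonUnitalStarSubalgebra.topologicalClosure_minimal _
      (NonUnitalStarAlgebra.adjoin_le ?_) hcl
    rintro _ ⟨s, x, rfl⟩
    exact ⟨(CuntzAlgebra.rep E).toFun x, (CuntzAlgebra.rep E).mem_cstar s x, rfl⟩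
  rw [eq_top_iff]
  intro a _
  obtain ⟨b, hb, hba⟩ := hle a.2
  exact (Subtype.ext hba : b = a) ▸ hb

/-- The coordinate projection of the direct sum of all Cuntz representations. -/
def evalHom (i : BundledCuntzRep E) :
    lp (fun i : BundledCuntzRep E => i.carrier) ∞ →⋆ₙₐ[ℂ] i.carrier where
  toFun a := a i
  map_smul' _ _ := rfl
  map_zero' := rfl
  map_add' _ _ := rfl
  map_mul' _ _ := rfl
  map_star' _ := rfl

variable {E} in
/-- Every Cuntz representation of `E` in a C⋆-algebra, of any universe, factors uniquely through
`i_E`. -/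
theorem CuntzAlgebra.existsUnique_lift [Countable P] {B : Type w} [NonUnitalCStarAlgebra B]
    (φ : CuntzRep E B) :
    ∃! π : CuntzAlgebra E →⋆ₙₐ[ℂ] B,
      ∀ (s : P) (x : E.fiber s), π ((CuntzAlgebra.rep E).toFun x) = φ.toFun x := by
  have hsep := φ.separable_cstar
  obtain ⟨A', hA', ⟨e⟩⟩ := exists_copy_of_separable φ.cstar
  let φ' : CuntzRep E A' :=
    (φ.codRestrict φ.cstar φ.mem_cstar).comp (e.symm : φ.cstar →⋆ₙₐ[ℂ] A')
  refine ⟨((NonUnitalStarSubalgebraClass.subtype φ.cstar).comp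
    (e : A' →⋆ₙₐ[ℂ] φ.cstar)).comp ((evalHom E ⟨A', φ'⟩).comp
      (NonUnitalStarSubalgebraClass.subtype (sumRep E).cstar)), fun s x => ?_, fun ρ hρ => ?_⟩
  · change ((e (e.symm ⟨φ.toFun x, φ.mem_cstar s x⟩) : φ.cstar) : B) = φ.toFun x
    rw [StarAlgEquiv.apply_symm_apply]
  · refine (CuntzAlgebra.rep E).cstar_hom_ext (CuntzAlgebra.cstar_eq_top E) _ _ fun s x => ?_
    rw [hρ]
    change φ.toFun x = ((e (e.symm ⟨φ.toFun x, φ.mem_cstar s x⟩) : φ.cstar) : B)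
    rw [StarAlgEquiv.apply_symm_apply]

end ProductSystem

section Lexicographic

variable {P : Type u} [Monoid P] (d : P →ₙ* ℕ+)

lemma lex_card_mul (s t : P) : ((d (s * t) : ℕ+) : ℕ) = (d s : ℕ) * (d t : ℕ) := by
  rw [map_mul, PNat.mul_coe]

lemma lex_card_one : ((d 1 : ℕ+) : ℕ) = 1 := by
  have h := lex_card_mul d 1 1
  rw [_root_.mul_one] at h
  exact (Nat.mul_right_cancel (d 1).pos (by rw [← h, _root_.one_mul])).symm

/-- The bijection `(j, k) ↦ j * d t + k` given by the lexicographic order. -/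
def lexIndex (s t : P) : Fin (d s) × Fin (d t) ≃ Fin (d (s * t)) :=
  finProdFinEquiv.trans (finCongr (lex_card_mul d s t).symm)

lemma lexIndex_val (s t : P) (j : Fin (d s)) (k : Fin (d t)) :
    (lexIndex d s t (j, k) : ℕ) = j * d t + k := by
  simp [lexIndex, Nat.add_comm, Nat.mul_comm]

/-- The bilinear multiplication `ℂ^{d(s)} × ℂ^{d(t)} → ℂ^{d(s t)}` with
`δ_j δ_k = δ_{j d(t) + k}`; see `lexMul_single`. -/
def lexMul (s t : P) : EuclideanSpace ℂ (Fin (d s)) →ₗ[ℂ] EuclideanSpace ℂ (Fin (d t)) →ₗ[ℂ]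
    EuclideanSpace ℂ (Fin (d (s * t))) :=
  LinearMap.mk₂ ℂ
    (fun x y => WithLp.toLp 2 fun i =>
      x ((lexIndex d s t).symm i).1 * y ((lexIndex d s t).symm i).2)
    (fun x x' y => by ext i; simp [add_mul])
    (fun c x y => by ext i; simp [_root_.mul_assoc])
    (fun x y y' => by ext i; simp [mul_add])
    (fun c x y => by ext i; simp [mul_left_comm])

lemma lexMul_lexIndex (s t : P) (x : EuclideanSpace ℂ (Fin (d s)))
    (y : EuclideanSpace ℂ (Fin (d t))) (j : Fin (d s)) (k : Fin (d t)) :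
    lexMul d s t x y (lexIndex d s t (j, k)) = x j * y k := by
  simp [lexMul]

lemma lexMul_single (s t : P) (j : Fin (d s)) (k : Fin (d t)) :
    lexMul d s t (EuclideanSpace.single j 1) (EuclideanSpace.single k 1)
      = EuclideanSpace.single (lexIndex d s t (j, k)) 1 := by
  ext i
  obtain ⟨⟨j', k'⟩, rfl⟩ := (lexIndex d s t).surjective i
  rw [lexMul_lexIndex]
  by_cases hj : j' = j <;> by_cases hk : k' = k <;> simp [hj, hk]

lemma lex_sigma_ext {p q : P} (h : p = q) (x : EuclideanSpace ℂ (Fin (d p)))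
    (y : EuclideanSpace ℂ (Fin (d q)))
    (hxy : ∀ (i : Fin (d p)) (j : Fin (d q)), (i : ℕ) = j → x i = y j) :
    (⟨p, x⟩ : Σ p, EuclideanSpace ℂ (Fin (d p))) = ⟨q, y⟩ := by
  subst h
  congr 1
  ext i
  exact hxy i i rfl

/-- The lexicographic product system `E(d)` determined by `d`: the fiber over `s` is `ℂ^{d(s)}`,
with `(s, δ_j) (t, δ_k) = (s t, δ_{j d(t) + k})`, extended bilinearly. -/
def lexProductSystem : ProductSystem.{u, 0} P where
  fiber s := EuclideanSpace ℂ (Fin (d s))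
  nontrivial s := by
    have : Nonempty (Fin (d s)) := ⟨⟨0, (d s).pos⟩⟩
    infer_instance
  mul {s t} := lexMul d s t
  mul_assoc {r s t} x y z := by
    refine lex_sigma_ext d (_root_.mul_assoc r s t) _ _ fun i j hij => ?_
    obtain ⟨⟨i', c⟩, rfl⟩ := (lexIndex d (r * s) t).surjective i
    obtain ⟨⟨a, b⟩, rfl⟩ := (lexIndex d r s).surjective i'
    obtain rfl : j = lexIndex d r (s * t) (a, lexIndex d s t (b, c)) := by
      apply Fin.ext
      rw [← hij]
      simp only [lexIndex_val, lex_card_mul]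
      ring
    simp only [lexMul_lexIndex, _root_.mul_assoc]
  inner_mul {s t} x x' y y' := by
    simp only [PiLp.inner_apply]
    rw [Finset.sum_mul_sum, ← Finset.sum_product', ← (lexIndex d s t).sum_comp]
    refine Finset.sum_congr rfl fun jk _ => ?_
    obtain ⟨j, k⟩ := jk
    rw [lexMul_lexIndex, lexMul_lexIndex]
    simp only [RCLike.inner_apply, map_mul]
    ring
  span_mul s t := by
    rw [eq_top_iff, ← (EuclideanSpace.basisFun (Fin (d (s * t))) ℂ).toBasis.span_eq]
    refine Submodule.span_mono ?_
    rintro _ ⟨i, rfl⟩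
    obtain ⟨⟨j, k⟩, rfl⟩ := (lexIndex d s t).surjective i
    refine ⟨EuclideanSpace.single j 1, EuclideanSpace.single k 1, ?_⟩
    rw [lexMul_single]
    simp
  finrank_fiber_one := by
    rw [finrank_euclideanSpace_fin]
    exact lex_card_one d
  one := WithLp.toLp 2 fun _ => 1
  one_mul {s} x := by
    refine lex_sigma_ext d (_root_.one_mul s) _ _ fun i j hij => ?_
    obtain ⟨⟨a, b⟩, rfl⟩ := (lexIndex d 1 s).surjective i
    have ha : (a : ℕ) = 0 := by have := a.2; have := lex_card_one d; omega
    obtain rfl : b = j := by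
      apply Fin.ext
      rw [← hij, lexIndex_val, ha]
      simp
    rw [lexMul_lexIndex]
    simp
  mul_one {s} x := by
    refine lex_sigma_ext d (_root_.mul_one s) _ _ fun i j hij => ?_
    obtain ⟨⟨a, b⟩, rfl⟩ := (lexIndex d s 1).surjective i
    have hb : (b : ℕ) = 0 := by have := b.2; have := lex_card_one d; omega
    obtain rfl : a = j := by
      apply Fin.ext
      rw [← hij, lexIndex_val, hb, lex_card_one]
      simp
    rw [lexMul_lexIndex]
    simp

end Lexicographic

/-- A C⋆-algebra is simple if it is nonzero and its only closed two-sided ideals are `0` and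
itself. -/
def IsSimpleCStarAlgebra (A : Type w) [NonUnitalCStarAlgebra A] : Prop :=
  Nontrivial A ∧ ∀ I : TwoSidedIdeal A, IsClosed (I : Set A) → I = ⊥ ∨ I = ⊤

end

/-! The generator `gen s j` behaves like the digit map `y ↦ (y + j) / d s` of `[0, 1)` together with
a degree `s`. If `d` is not injective, the degree can be forgotten: the maps act on `ℓ²([0, 1) ×
G)`, with `s` translating `G` either through an embedding `h` or trivially (`digitRep`). The trivial
choice identifies `gen s 0` and `gen t 0` whenever `d s = d t`, the other separates them when `s ≠
t`. So the kernel of the first representation is a proper nonzero closed ideal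
(`injective_of_isSimple`).

Conversely, let `d` be injective and `I` a closed ideal without `unit`. Linear combinations of words
`v w*` are dense, and by commutativity finitely many words have a common denominator `t`, so an
element of `I` is close to a finite sum of `f s ∈ fracSpan s t`. For `s ≠ t` the numbers `d s` and
`d t` differ, and one contraction `W` can be chosen with `W* (f s) W = 0` for these `s` and `W* (f
t) W = f t` (`CuntzRep.exists_compressor`). The term `f t` lies in a matrix algebra, whose norm is
at most the distance to `I` (`CuntzRep.norm_le_of_mem_ideal`), so `f t` is small.

Averages over the powers of one gauge automorphism then play the role of a conditional expectation.
For an injective character of `P` they damp every `f s` with `s ≠ t` as geometric sums, so the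
averages of an element of `I` tend to zero (`CuntzRep.norm_sum_gauge_le`). But gauge orbits are
precompact, and by pigeonhole the averages of a nonzero `a* a` stay away from zero
(`mul_le_card_mul_norm_sum`). Hence `I = 0` (`CuntzRep.ideal_eq_bot_or_top`). -/

noncomputable section

namespace ProductSystem

/-! ### Linearity of representations and relations among the generators -/

section Linearity

variable {P : Type u} [Monoid P] {E : ProductSystem.{u, v} P} {B : Type w}
  [NonUnitalCStarAlgebra B] (φ : Representation E B)

/-- The defect `δ` satisfies `δ* δ = 0`: its expansion involves only inner products times `φ(1)`,
and these cancel. -/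
lemma Representation.map_add {s : P} (x y : E.fiber s) :
    φ.toFun (x + y) = φ.toFun x + φ.toFun y := by
  rw [← sub_eq_zero, ← CStarRing.star_mul_self_eq_zero_iff]
  simp only [star_sub, star_add, sub_mul, mul_sub, add_mul, mul_add, φ.star_mul, inner_add_left,
    inner_add_right, add_smul]
  abel

lemma Representation.map_smul {s : P} (c : ℂ) (x : E.fiber s) :
    φ.toFun (c • x) = c • φ.toFun x := by
  rw [← sub_eq_zero, ← CStarRing.star_mul_self_eq_zero_iff]
  simp only [star_sub, star_smul, sub_mul, mul_sub, smul_mul_assoc, mul_smul_comm, φ.star_mul,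
    inner_smul_left, inner_smul_right, mul_smul, RCLike.star_def]
  rw [smul_comm c (starRingEnd ℂ c)]
  simp

lemma Representation.toFun_sigma {p q : P} {x : E.fiber p} {y : E.fiber q}
    (h : (⟨p, x⟩ : Σ p, E.fiber p) = ⟨q, y⟩) : φ.toFun x = φ.toFun y :=
  congrArg (fun z : (Σ p, E.fiber p) => φ.toFun z.2) h

lemma Representation.one_mul_map {s : P} (x : E.fiber s) :
    φ.toFun E.one * φ.toFun x = φ.toFun x := by
  rw [← φ.map_mul, φ.toFun_sigma (E.one_mul x)]

lemma Representation.map_mul_one {s : P} (x : E.fiber s) :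
    φ.toFun x * φ.toFun E.one = φ.toFun x := by
  rw [← φ.map_mul, φ.toFun_sigma (E.mul_one x)]

lemma Representation.star_map_one : star (φ.toFun E.one) = φ.toFun E.one := by
  have h : star (φ.toFun E.one) * φ.toFun E.one = φ.toFun E.one := by
    rw [φ.star_mul, inner_self_eq_norm_sq_to_K, E.norm_one]; simp
  calc star (φ.toFun E.one) = star (star (φ.toFun E.one) * φ.toFun E.one) := by rw [h]
    _ = star (φ.toFun E.one) * φ.toFun E.one := by rw [StarMul.star_mul, star_star]
    _ = φ.toFun E.one := h

end Linearity

section Generators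

variable {P : Type u} [Monoid P] {d : P →ₙ* ℕ+} {B : Type w} [NonUnitalCStarAlgebra B]
  (φ : CuntzRep (lexProductSystem d) B)

/-- The image of the identity of the product system. -/
def CuntzRep.unit : B := φ.toFun (lexProductSystem d).one

/-- A Cuntz representation of a lexicographic product system, as a linear map on a fiber. -/
def CuntzRep.vec (s : P) : EuclideanSpace ℂ (Fin (d s)) →ₗ[ℂ] B where
  toFun x := φ.toFun (s := s) x
  map_add' x y := φ.map_add (s := s) x y
  map_smul' c x := φ.map_smul (s := s) c x

lemma CuntzRep.vec_mul_vec {r s : P} (x : EuclideanSpace ℂ (Fin (d r)))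
    (y : EuclideanSpace ℂ (Fin (d s))) :
    φ.vec r x * φ.vec s y = φ.vec (r * s) (lexMul d r s x y) :=
  (φ.map_mul (s := r) (t := s) x y).symm

lemma CuntzRep.star_vec_mul_vec {s : P} (x y : EuclideanSpace ℂ (Fin (d s))) :
    star (φ.vec s x) * φ.vec s y = ⟪x, y⟫_ℂ • φ.unit :=
  φ.star_mul (s := s) y x

lemma CuntzRep.sum_vec_mul_star (s : P)
    (b : OrthonormalBasis (Fin (d s)) ℂ (EuclideanSpace ℂ (Fin (d s)))) :
    ∑ i, φ.vec s (b i) * star (φ.vec s (b i)) = φ.unit :=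
  φ.sum_mul_star s (d s) b

lemma CuntzRep.norm_vec_le {s : P} (x : EuclideanSpace ℂ (Fin (d s))) : ‖φ.vec s x‖ ≤ ‖x‖ :=
  φ.norm_le (s := s) x

/-- The image of the `n`-th canonical basis vector of the fiber over `s`; zero if there is none. -/
def CuntzRep.gen (s : P) (n : ℕ) : B :=
  if h : n < d s then φ.vec s (EuclideanSpace.single (⟨n, h⟩ : Fin (d s)) (1 : ℂ)) else 0

lemma CuntzRep.gen_fin (s : P) (j : Fin (d s)) :
    φ.gen s j = φ.vec s (EuclideanSpace.single j (1 : ℂ)) := by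
  simp [gen]

lemma CuntzRep.gen_of_le {s : P} {n : ℕ} (h : d s ≤ n) : φ.gen s n = 0 := by
  simp [gen, not_lt.mpr h]

/-- Only `k` needs a bound: an excessive `j` makes `j * d s + k` excessive too, so both sides
vanish, whereas an excessive `k` may give the index of another basis vector. -/
lemma CuntzRep.gen_mul_gen (r s : P) (j : ℕ) {k : ℕ} (hk : k < d s) :
    φ.gen r j * φ.gen s k = φ.gen (r * s) (j * d s + k) := by
  by_cases hj : j < d r
  · have h := φ.vec_mul_vec (EuclideanSpace.single (⟨j, hj⟩ : Fin (d r)) (1 : ℂ))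
      (EuclideanSpace.single (⟨k, hk⟩ : Fin (d s)) (1 : ℂ))
    rwa [lexMul_single, ← φ.gen_fin, ← φ.gen_fin, ← φ.gen_fin, lexIndex_val] at h
  · rw [not_lt] at hj
    rw [φ.gen_of_le hj, zero_mul, φ.gen_of_le]
    rw [lex_card_mul]
    exact (Nat.mul_le_mul_right _ hj).trans (Nat.le_add_right _ _)

lemma CuntzRep.unit_mul_gen (s : P) (n : ℕ) : φ.unit * φ.gen s n = φ.gen s n := by
  unfold gen unit
  split_ifs
  · exact φ.one_mul_map _
  · simp

lemma CuntzRep.gen_mul_unit (s : P) (n : ℕ) : φ.gen s n * φ.unit = φ.gen s n := by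
  unfold gen unit
  split_ifs
  · exact φ.map_mul_one _
  · simp

lemma CuntzRep.star_unit : star φ.unit = φ.unit := φ.star_map_one

lemma CuntzRep.unit_mul_star_gen (s : P) (n : ℕ) :
    φ.unit * star (φ.gen s n) = star (φ.gen s n) := by
  rw [← φ.star_unit, ← star_mul, gen_mul_unit]

lemma CuntzRep.star_gen_mul_gen {s : P} {j : ℕ} (hj : j < d s) (k : ℕ) :
    star (φ.gen s j) * φ.gen s k = if j = k then φ.unit else 0 := by
  by_cases hk : k < d s
  · have h := φ.star_vec_mul_vec (EuclideanSpace.single (⟨j, hj⟩ : Fin (d s)) (1 : ℂ))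
      (EuclideanSpace.single (⟨k, hk⟩ : Fin (d s)) (1 : ℂ))
    rw [← φ.gen_fin, ← φ.gen_fin, EuclideanSpace.inner_single_left] at h
    refine h.trans ?_
    by_cases hjk : j = k <;> simp [hjk]
  · rw [not_lt] at hk
    rw [φ.gen_of_le hk, mul_zero, if_neg (by omega)]

lemma CuntzRep.sum_gen_mul_star (s : P) :
    ∑ j ∈ Finset.range (d s), φ.gen s j * star (φ.gen s j) = φ.unit := by
  have h := φ.sum_vec_mul_star s (EuclideanSpace.basisFun (Fin (d s)) ℂ)
  rw [← Fin.sum_univ_eq_sum_range (fun j => φ.gen s j * star (φ.gen s j))]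
  refine Eq.trans ?_ h
  refine Finset.sum_congr rfl fun j _ => ?_
  rw [EuclideanSpace.basisFun_apply, φ.gen_fin]

lemma CuntzRep.gen_one : φ.gen 1 0 = φ.unit := by
  have h0 : 0 < (d 1 : ℕ) := (d 1).pos
  unfold gen
  rw [dif_pos h0]
  change φ.vec 1 _ = φ.vec 1 (WithLp.toLp 2 fun _ => 1)
  congr 1
  ext i
  have hi : i = ⟨0, h0⟩ := Fin.ext (by have := i.2; have := lex_card_one d; simp; omega)
  simp [hi]

lemma CuntzRep.vec_eq_sum {s : P} (x : EuclideanSpace ℂ (Fin (d s))) :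
    φ.vec s x = ∑ j : Fin (d s), x j • φ.gen s j := by
  conv_lhs => rw [← (EuclideanSpace.basisFun (Fin (d s)) ℂ).sum_repr x]
  simp [gen_fin]

end Generators

end ProductSystem

/-! ### Avoiding finitely many coincidences -/

/-- Affine functions of `m < R` with distinct slopes take values far apart for some `m`, once `R`
is large. -/
lemma exists_lt_forall_add_le_dist {ι : Type*} (S : Finset ι) (D : ι → ℕ) (T R : ℕ)
    (hD : ∀ s ∈ S, D s ≠ T) (hR : ∑ s ∈ S, T * (D s * (2 * (D s + T))) < R) :
    ∃ m < R, ∀ s ∈ S, ∀ i < T, ∀ j < D s,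
      ((D s + T : ℕ) : ℤ) ≤ |((i * R + m : ℕ) : ℤ) * D s - ((j * R + m : ℕ) : ℤ) * T| := by
  classical
  let f : ι → ℕ → ℕ → ℕ → ℤ := fun s i j m =>
    ((i * R + m : ℕ) : ℤ) * D s - ((j * R + m : ℕ) : ℤ) * T
  -- The `m` to avoid, for fixed `s`, `i`, `j`. Since `f s i j` is affine in `m` with slope `D s - T
  -- ≠ 0`, it is injective, so there are no more of them than integers of absolute value below `D s
  -- + T`.
  let bad : ι → ℕ → ℕ → Finset ℕ := fun s i j =>
    (Finset.range R).filter fun m => |f s i j m| < ((D s + T : ℕ) : ℤ)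
  have hbad : ∀ s ∈ S, ∀ i j, (bad s i j).card ≤ 2 * (D s + T) := by
    intro s hs i j
    have h1 : (bad s i j).card
        ≤ (Finset.Ioo (-((D s + T : ℕ) : ℤ)) ((D s + T : ℕ) : ℤ)).card := by
      refine Finset.card_le_card_of_injOn (f s i j) (fun m hm => ?_) fun m _ m' _ hmm => ?_
      · have h := (Finset.mem_filter.mp hm).2
        exact Finset.mem_coe.mpr (Finset.mem_Ioo.mpr (abs_lt.mp h))
      · have h2 : ((m : ℤ) - m') * ((D s : ℤ) - T) = 0 := by
          have h3 : f s i j m = f s i j m' := hmm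
          simp only [f] at h3
          push_cast at h3
          linear_combination h3
        have h4 : (D s : ℤ) - T ≠ 0 := sub_ne_zero.mpr (by exact_mod_cast hD s hs)
        have h5 := (mul_eq_zero.mp h2).resolve_right h4
        omega
    refine h1.trans ?_
    rw [Int.card_Ioo]
    omega
  let all : Finset ℕ := S.biUnion fun s =>
    (Finset.range T).biUnion fun i => (Finset.range (D s)).biUnion fun j => bad s i j
  have hall : all.card < (Finset.range R).card := by
    rw [Finset.card_range]
    refine lt_of_le_of_lt ?_ hR
    refine Finset.card_biUnion_le.trans (Finset.sum_le_sum fun s hs => ?_)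
    refine (Finset.card_biUnion_le_card_mul _ _ _ fun i _ =>
      Finset.card_biUnion_le_card_mul _ _ _ fun j _ => hbad s hs i j).trans ?_
    simp
  obtain ⟨m, hm, hm'⟩ := Finset.exists_mem_notMem_of_card_lt_card hall
  refine ⟨m, Finset.mem_range.mp hm, fun s hs i hi j hj => ?_⟩
  by_contra! h
  refine hm' ?_
  simp only [all, Finset.mem_biUnion, Finset.mem_range]
  exact ⟨s, hs, i, hi, j, hj, Finset.mem_filter.mpr ⟨hm, h⟩⟩

/-! ### The ⋆-algebra of words and the compression to degree zero -/

namespace ProductSystem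

variable {P : Type u} [CommMonoid P] {d : P →ₙ* ℕ+} {B : Type w} [NonUnitalCStarAlgebra B]
  (φ : CuntzRep (lexProductSystem d) B)

/-- Expanding the unit over the fiber of `t` turns `gen s m` into products over `s * t = t * s`.
Refactoring these in the other order is division with remainder by `d s`, and `star (gen t n)`
selects the quotient `n`. This exchange rule is where commutativity of `P` enters the multiplication
of words. -/
lemma CuntzRep.star_gen_mul_gen_eq_sum (s t : P) {n : ℕ} (hn : n < d t) (m : ℕ) :
    star (φ.gen t n) * φ.gen s m = ∑ i ∈ Finset.range (d t),
      if n = (m * d t + i) / d s then φ.gen s ((m * d t + i) % d s) * star (φ.gen t i) else 0 := by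
  rw [← φ.gen_mul_unit s m, ← φ.sum_gen_mul_star t, Finset.mul_sum, Finset.mul_sum]
  refine Finset.sum_congr rfl fun i hi => ?_
  have h1 : φ.gen s m * φ.gen t i
      = φ.gen t ((m * d t + i) / d s) * φ.gen s ((m * d t + i) % d s) := by
    rw [φ.gen_mul_gen _ _ _ (Finset.mem_range.mp hi),
      φ.gen_mul_gen _ _ _ (Nat.mod_lt _ (d s).pos), mul_comm s t, Nat.div_add_mod']
  rw [← _root_.mul_assoc (φ.gen s m), h1, ← _root_.mul_assoc, ← _root_.mul_assoc,
    φ.star_gen_mul_gen hn]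
  split_ifs
  · rw [unit_mul_gen]
  · simp

/-- The ranges of two generators are orthogonal if the corresponding intervals
`[n / d t, (n + 1) / d t)` and `[m / d s, (m + 1) / d s)` are disjoint. -/
lemma CuntzRep.star_gen_mul_gen_eq_zero {s t : P} {n m : ℕ}
    (h : (n + 1) * d s ≤ m * d t ∨ (m + 1) * d t ≤ n * d s) :
    star (φ.gen t n) * φ.gen s m = 0 := by
  rcases lt_or_ge n (d t : ℕ) with hn | hn
  · rw [φ.star_gen_mul_gen_eq_sum s t hn]
    -- A surviving term would give `n * d s ≤ m * d t + i < (n + 1) * d s` with `0 ≤ i < d t`, so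
    -- the two intervals would overlap.
    refine Finset.sum_eq_zero fun i hi => if_neg fun hni => ?_
    have hi := Finset.mem_range.mp hi
    have h1 := Nat.div_add_mod' (m * d t + i) (d s)
    have h2 := Nat.mod_lt (m * d t + i) (d s).pos
    rw [← hni] at h1
    have h3 := Nat.zero_le ((m * d t + i) % d s)
    rcases h with h | h <;> nlinarith
  · rw [φ.gen_of_le hn, star_zero, zero_mul]

/-- The span of the products `v w*` with `v`, `w` in the images of the fibers over `s`, `t`. -/
def CuntzRep.fracSpan (s t : P) : Submodule ℂ B :=
  Submodule.span ℂ {b | ∃ j k, φ.gen s j * star (φ.gen t k) = b}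

lemma CuntzRep.mem_fracSpan (s t : P) (j k : ℕ) :
    φ.gen s j * star (φ.gen t k) ∈ φ.fracSpan s t :=
  Submodule.subset_span ⟨j, k, rfl⟩

/-- Fractions can be expanded: inserting the unit `∑ u u*` over the fiber of `r` gives `v w* = ∑ (v
u) (w u)*`. -/
lemma CuntzRep.fracSpan_le_mul (s t r : P) : φ.fracSpan s t ≤ φ.fracSpan (s * r) (t * r) := by
  refine Submodule.span_le.mpr ?_
  rintro _ ⟨j, k, rfl⟩
  rw [← φ.gen_mul_unit s j, ← φ.sum_gen_mul_star r, Finset.mul_sum, Finset.sum_mul]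
  refine Submodule.sum_mem _ fun i hi => ?_
  have hi := Finset.mem_range.mp hi
  rw [_root_.mul_assoc, _root_.mul_assoc, ← StarMul.star_mul, ← _root_.mul_assoc,
    φ.gen_mul_gen _ _ _ hi, φ.gen_mul_gen _ _ _ hi]
  exact φ.mem_fracSpan _ _ _ _

/-- The span of the products `v w*` with `v`, `w` in the images of fibers. -/
def CuntzRep.words : Submodule ℂ B := ⨆ t, ⨆ s, φ.fracSpan s t

lemma CuntzRep.fracSpan_le_words (s t : P) : φ.fracSpan s t ≤ φ.words :=
  (le_iSup (fun s => φ.fracSpan s t) s).trans (le_iSup (fun t => ⨆ s, φ.fracSpan s t) t)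

/-- Common denominators: expanding fractions makes the family directed, with `t * t'` above both `t`
and `t'`. -/
lemma CuntzRep.exists_mem_of_mem_words {a : B} (ha : a ∈ φ.words) :
    ∃ t, a ∈ ⨆ s, φ.fracSpan s t := by
  have hle : ∀ t r, ⨆ s, φ.fracSpan s t ≤ ⨆ s, φ.fracSpan s (t * r) := fun t r =>
    iSup_le fun s => (φ.fracSpan_le_mul s t r).trans (le_iSup (fun s => φ.fracSpan s (t * r)) _)
  refine (Submodule.mem_iSup_of_directed _ fun t t' => ⟨t * t', hle t t', ?_⟩).mp ha
  rw [mul_comm t t']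
  exact hle t' t

lemma CuntzRep.words_induction {p : B → Prop} {a : B} (ha : a ∈ φ.words) (h0 : p 0)
    (hadd : ∀ x y, p x → p y → p (x + y)) (hsmul : ∀ (c : ℂ) x, p x → p (c • x))
    (hgen : ∀ s t j k, p (φ.gen s j * star (φ.gen t k))) : p a := by
  let M : Submodule ℂ B :=
    { carrier := {x | p x}
      add_mem' := fun hx hy => hadd _ _ hx hy
      zero_mem' := h0
      smul_mem' := fun c x hx => hsmul c x hx }
  have h : φ.words ≤ M := by
    refine iSup_le fun t => iSup_le fun s => Submodule.span_le.mpr ?_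
    rintro _ ⟨j, k, rfl⟩
    exact hgen s t j k
  exact h ha

lemma CuntzRep.gen_mul_star_mem_words (s t : P) (j k : ℕ) :
    φ.gen s j * star (φ.gen t k) ∈ φ.words :=
  φ.fracSpan_le_words s t (φ.mem_fracSpan s t j k)

lemma CuntzRep.gen_mul_gen_mul_star_mem_words (s t r : P) (i j k : ℕ) :
    φ.gen r i * φ.gen s j * star (φ.gen t k) ∈ φ.words := by
  rcases lt_or_ge j (d s : ℕ) with hj | hj
  · rw [φ.gen_mul_gen _ _ _ hj]
    exact φ.gen_mul_star_mem_words _ _ _ _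
  · simp [φ.gen_of_le hj]

lemma CuntzRep.star_mem_words {a : B} (ha : a ∈ φ.words) : star a ∈ φ.words := by
  refine φ.words_induction ha (p := fun a => star a ∈ φ.words) (by simp) (fun x y hx hy => ?_)
    (fun c x hx => ?_) fun s t j k => ?_
  · rw [star_add]
    exact add_mem hx hy
  · rw [star_smul]
    exact Submodule.smul_mem _ _ hx
  · rw [StarMul.star_mul, star_star]
    exact φ.gen_mul_star_mem_words _ _ _ _

lemma CuntzRep.gen_mul_mem_words (r : P) (i : ℕ) {a : B} (ha : a ∈ φ.words) :
    φ.gen r i * a ∈ φ.words := by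
  refine φ.words_induction ha (p := fun a => φ.gen r i * a ∈ φ.words) (by simp)
    (fun x y hx hy => ?_) (fun c x hx => ?_) fun s t j k => ?_
  · rw [mul_add]
    exact add_mem hx hy
  · rw [mul_smul_comm]
    exact Submodule.smul_mem _ _ hx
  · rw [← _root_.mul_assoc]
    exact φ.gen_mul_gen_mul_star_mem_words _ _ _ _ _ _

lemma CuntzRep.star_gen_mul_mem_words (r : P) (i : ℕ) {a : B} (ha : a ∈ φ.words) :
    star (φ.gen r i) * a ∈ φ.words := by
  refine φ.words_induction ha (p := fun a => star (φ.gen r i) * a ∈ φ.words) (by simp)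
    (fun x y hx hy => ?_) (fun c x hx => ?_) fun s t j k => ?_
  · rw [mul_add]
    exact add_mem hx hy
  · rw [mul_smul_comm]
    exact Submodule.smul_mem _ _ hx
  · rcases lt_or_ge i (d r : ℕ) with hi | hi
    · rw [← _root_.mul_assoc, φ.star_gen_mul_gen_eq_sum s r hi, Finset.sum_mul]
      refine Submodule.sum_mem _ fun n _ => ?_
      split_ifs
      · rw [_root_.mul_assoc, ← StarMul.star_mul]
        have h := φ.star_mem_words (φ.gen_mul_gen_mul_star_mem_words r s t k n
          ((j * d r + n) % d s))
        rwa [StarMul.star_mul, star_star] at h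
      · simp
    · simp [φ.gen_of_le hi]

/-- The span of the products `v w*` is a ⋆-subalgebra. -/
def CuntzRep.wordAlgebra : NonUnitalStarSubalgebra ℂ B where
  __ := φ.words
  mul_mem' {a b} ha hb := by
    refine φ.words_induction ha (p := fun a => a * b ∈ φ.words) (by simp) (fun x y hx hy => ?_)
      (fun c x hx => ?_) fun s t j k => ?_
    · rw [add_mul]
      exact add_mem hx hy
    · rw [smul_mul_assoc]
      exact Submodule.smul_mem _ _ hx
    · rw [_root_.mul_assoc]
      exact φ.gen_mul_mem_words _ _ (φ.star_gen_mul_mem_words _ _ hb)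
  star_mem' ha := φ.star_mem_words ha

lemma CuntzRep.gen_mem_words (s : P) (j : ℕ) : φ.gen s j ∈ φ.words := by
  rw [← φ.gen_mul_unit, ← φ.star_unit, ← φ.gen_one]
  exact φ.gen_mul_star_mem_words _ _ _ _

lemma CuntzRep.vec_mem_words {s : P} (x : EuclideanSpace ℂ (Fin (d s))) :
    φ.vec s x ∈ φ.words := by
  rw [vec_eq_sum]
  exact Submodule.sum_mem _ fun j _ => Submodule.smul_mem _ _ (φ.gen_mem_words _ _)

lemma CuntzRep.exists_words_near {a : B} (ha : a ∈ φ.cstar) {ε : ℝ} (hε : 0 < ε) :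
    ∃ b ∈ φ.words, ‖a - b‖ < ε := by
  have hle : φ.cstar ≤ φ.wordAlgebra.topologicalClosure := by
    refine NonUnitalStarSubalgebra.topologicalClosure_mono (NonUnitalStarAlgebra.adjoin_le ?_)
    rintro _ ⟨s, x, rfl⟩
    exact φ.vec_mem_words x
  have h1 : a ∈ closure (φ.words : Set B) := hle ha
  obtain ⟨b, hb, hab⟩ := Metric.mem_closure_iff.mp h1 ε hε
  exact ⟨b, hb, by rwa [← dist_eq_norm]⟩

lemma CuntzRep.norm_unit_le : ‖φ.unit‖ ≤ 1 :=
  (φ.norm_le _).trans_eq (lexProductSystem d).norm_one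

/-- The isometry that replaces each minimal projection of the matrix algebra spanned by the
products `v w*`, with `v`, `w` in the fiber over `t`, by one of its subprojections. -/
def CuntzRep.compressor (t r : P) (m : ℕ) : B :=
  ∑ i ∈ Finset.range (d t), φ.gen t i * φ.gen r m * star (φ.gen t i)

/-- Orthogonality leaves only the summand `i = k`, so `star (gen t k)` passes through the compressor
at the cost of a factor `gen r m`. -/
lemma CuntzRep.star_gen_mul_compressor (t r : P) (m k : ℕ) :
    star (φ.gen t k) * φ.compressor t r m = φ.gen r m * star (φ.gen t k) := by
  rcases lt_or_ge k (d t : ℕ) with hk | hk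
  · rw [compressor, Finset.mul_sum]
    simp only [← _root_.mul_assoc, φ.star_gen_mul_gen hk, ite_mul, zero_mul, unit_mul_gen]
    simp [hk]
  · simp [φ.gen_of_le hk]

lemma CuntzRep.star_compressor_mul_gen (t r : P) (m k : ℕ) :
    star (φ.compressor t r m) * φ.gen t k = φ.gen t k * star (φ.gen r m) := by
  have h := congrArg star (φ.star_gen_mul_compressor t r m k)
  simpa using h

lemma CuntzRep.norm_compressor_le (t r : P) {m : ℕ} (hm : m < d r) :
    ‖φ.compressor t r m‖ ≤ 1 := by
  have h : star (φ.compressor t r m) * φ.compressor t r m = φ.unit := by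
    conv_lhs => rw [compressor, Finset.mul_sum]
    rw [← φ.sum_gen_mul_star t]
    refine Finset.sum_congr rfl fun i hi => ?_
    rw [← _root_.mul_assoc, ← _root_.mul_assoc]
    change star (φ.compressor t r m) * _ * _ * _ = _
    rw [star_compressor_mul_gen, _root_.mul_assoc (φ.gen t i), φ.star_gen_mul_gen hm, if_pos rfl,
      gen_mul_unit]
  have h2 : ‖φ.compressor t r m‖ * ‖φ.compressor t r m‖ ≤ 1 := by
    rw [← CStarRing.norm_star_mul_self, h]
    exact φ.norm_unit_le
  nlinarith [norm_nonneg (φ.compressor t r m)]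

/-- Passing the compressors through `v w*` leaves `star (gen r m) * gen r m = unit` in the middle.
-/
lemma CuntzRep.compress_of_mem {t r : P} {m : ℕ} (hm : m < d r) {y : B}
    (hy : y ∈ φ.fracSpan t t) :
    star (φ.compressor t r m) * y * φ.compressor t r m = y := by
  refine Submodule.span_induction (p := fun y _ =>
    star (φ.compressor t r m) * y * φ.compressor t r m = y) ?_ (by simp)
    (fun x y _ _ hx hy => ?_) (fun c x _ hx => ?_) hy
  · rintro _ ⟨j, k, rfl⟩
    rw [← _root_.mul_assoc, star_compressor_mul_gen, _root_.mul_assoc, star_gen_mul_compressor,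
      _root_.mul_assoc, ← _root_.mul_assoc (star _), φ.star_gen_mul_gen hm, if_pos rfl,
      unit_mul_star_gen]
  · rw [mul_add, add_mul, hx, hy]
  · rw [mul_smul_comm, smul_mul_assoc, hx]

/-- For words of nonzero degree the middle factors are `(gen t i * gen r m)* (gen s j * gen r m)`,
and these vanish when the corresponding subintervals are disjoint, which is how `h` is obtained. -/
lemma CuntzRep.compress_eq_zero_of_mem {s t r : P} {m : ℕ} (hm : m < d r)
    (h : ∀ i < (d t : ℕ), ∀ j < (d s : ℕ),
      star (φ.gen (t * r) (i * d r + m)) * φ.gen (s * r) (j * d r + m) = 0) {y : B}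
    (hy : y ∈ φ.fracSpan s t) :
    star (φ.compressor t r m) * y * φ.compressor t r m = 0 := by
  refine Submodule.span_induction (p := fun y _ =>
    star (φ.compressor t r m) * y * φ.compressor t r m = 0) ?_ (by simp)
    (fun x y _ _ hx hy => ?_) (fun c x _ hx => ?_) hy
  · rintro _ ⟨j, k, rfl⟩
    rcases lt_or_ge j (d s : ℕ) with hj | hj
    · have h1 : star (φ.compressor t r m) * φ.gen s j * φ.gen r m = 0 := by
        rw [compressor, star_sum, Finset.sum_mul, Finset.sum_mul]
        refine Finset.sum_eq_zero fun i hi => ?_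
        rw [φ.gen_mul_gen _ _ _ hm, StarMul.star_mul, star_star, _root_.mul_assoc,
          φ.gen_mul_gen _ _ _ hm, _root_.mul_assoc, h i (Finset.mem_range.mp hi) j hj, mul_zero]
      rw [← _root_.mul_assoc, _root_.mul_assoc _ (star (φ.gen t k)), star_gen_mul_compressor,
        ← _root_.mul_assoc, h1, zero_mul]
    · simp [φ.gen_of_le hj]
  · rw [mul_add, add_mul, hx, hy, add_zero]
  · rw [mul_smul_comm, smul_mul_assoc, hx, smul_zero]

lemma exists_lt_card_of_ne_one {r : P} (hr : d r ≠ 1) (C : ℕ) : ∃ s, C < (d s : ℕ) := by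
  have hr2 : 2 ≤ (d r : ℕ) := by
    have h1 := (d r).pos
    have h2 : (d r : ℕ) ≠ 1 := fun h => hr (PNat.eq h)
    omega
  have hpow : ∀ n : ℕ, n < (d (r ^ n) : ℕ) := by
    intro n
    induction n with
    | zero => exact (d _).pos
    | succ n ih =>
      rw [pow_succ, lex_card_mul]
      nlinarith
  exact ⟨_, hpow C⟩

/-- If `d` is injective, a single contraction compresses finitely many nonzero degrees to zero and
fixes the part of degree zero. -/
lemma CuntzRep.exists_compressor (hd : Function.Injective d) (t : P) (S : Finset P) (hS : t ∉ S) :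
    ∃ W : B, ‖W‖ ≤ 1 ∧ (∀ s ∈ S, ∀ y ∈ φ.fracSpan s t, star W * y * W = 0) ∧
      ∀ y ∈ φ.fracSpan t t, star W * y * W = y := by
  have hne : ∀ s ∈ S, (d s : ℕ) ≠ d t := fun s hs h => hS (hd (PNat.eq h) ▸ hs)
  let C : ℕ := ∑ s ∈ S, (d t : ℕ) * (d s * (2 * (d s + d t)))
  -- If `S` is nonempty, `d s ≠ d t` for some `s`, so one of the two is not `1` and its powers make
  -- `d r` arbitrarily large. If `S` is empty, `C = 0` and `r = 1` will do.
  have hr : ∃ r, C < (d r : ℕ) := by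
    rcases S.eq_empty_or_nonempty with h | ⟨s, hs⟩
    · refine ⟨1, ?_⟩
      simp only [C, h, Finset.sum_empty]
      exact (d 1).pos
    · by_cases h1 : d s = 1
      · refine exists_lt_card_of_ne_one (r := t) (fun h2 => hne s hs ?_) C
        rw [h1, h2]
      · exact exists_lt_card_of_ne_one h1 C
  obtain ⟨r, hr⟩ := hr
  obtain ⟨m, hm, h⟩ := exists_lt_forall_add_le_dist S (fun s => (d s : ℕ)) (d t) (d r) hne hr
  refine ⟨φ.compressor t r m, φ.norm_compressor_le t r hm, fun s hs y hy => ?_,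
    fun y hy => φ.compress_of_mem hm hy⟩
  refine φ.compress_eq_zero_of_mem hm (fun i hi j hj => φ.star_gen_mul_gen_eq_zero ?_) hy
  have h1 := h s hs i hi j hj
  rw [lex_card_mul, lex_card_mul, ← _root_.mul_assoc, ← _root_.mul_assoc, ← _root_.mul_assoc,
    ← _root_.mul_assoc]
  -- After cancelling `d r`, disjointness of the intervals asks for a gap of at least `d t` in one
  -- direction or `d s` in the other; the distance `d s + d t` covers both cases.
  refine Or.imp (fun h2 => Nat.mul_le_mul_right _ h2) (fun h2 => Nat.mul_le_mul_right _ h2) ?_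
  rcases le_abs'.mp h1 with h2 | h2
  · left
    zify
    push_cast at h2
    have : (0 : ℤ) ≤ d t := by positivity
    linarith
  · right
    zify
    push_cast at h2
    have : (0 : ℤ) ≤ d s := by positivity
    linarith

end ProductSystem

/-! ### Matrix algebras and their distance to a closed ideal -/

namespace ProductSystem

section Matrix

variable {P : Type u} [Monoid P] {d : P →ₙ* ℕ+} {B : Type w} [NonUnitalCStarAlgebra B]
  (φ : CuntzRep (lexProductSystem d) B)

lemma CuntzRep.unit_mul_vec {s : P} (x : EuclideanSpace ℂ (Fin (d s))) :
    φ.unit * φ.vec s x = φ.vec s x :=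
  φ.one_mul_map (s := s) x

lemma CuntzRep.vec_mul_unit {s : P} (x : EuclideanSpace ℂ (Fin (d s))) :
    φ.vec s x * φ.unit = φ.vec s x :=
  φ.map_mul_one (s := s) x

/-- The linear map underlying `CuntzRep.matrixHom`. -/
def CuntzRep.matrixMap (t : P) (T : EuclideanSpace ℂ (Fin (d t)) →L[ℂ] EuclideanSpace ℂ (Fin (d t))) :
    B :=
  ∑ j, φ.vec t (T (EuclideanSpace.basisFun (Fin (d t)) ℂ j)) *
    star (φ.vec t (EuclideanSpace.basisFun (Fin (d t)) ℂ j))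

lemma CuntzRep.matrixMap_mul_vec (t : P)
    (T : EuclideanSpace ℂ (Fin (d t)) →L[ℂ] EuclideanSpace ℂ (Fin (d t)))
    (x : EuclideanSpace ℂ (Fin (d t))) : φ.matrixMap t T * φ.vec t x = φ.vec t (T x) := by
  conv_rhs => rw [← (EuclideanSpace.basisFun (Fin (d t)) ℂ).sum_repr' x]
  rw [matrixMap, Finset.sum_mul, map_sum, map_sum]
  refine Finset.sum_congr rfl fun j _ => ?_
  rw [_root_.mul_assoc, star_vec_mul_vec, mul_smul_comm, vec_mul_unit, _root_.map_smul,
    _root_.map_smul]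

lemma CuntzRep.matrixMap_mul (t : P)
    (T S : EuclideanSpace ℂ (Fin (d t)) →L[ℂ] EuclideanSpace ℂ (Fin (d t))) :
    φ.matrixMap t (T * S) = φ.matrixMap t T * φ.matrixMap t S := by
  conv_rhs => rw [matrixMap.eq_def φ t S, Finset.mul_sum]
  refine Finset.sum_congr rfl fun j _ => ?_
  rw [← _root_.mul_assoc, matrixMap_mul_vec]
  rfl

lemma CuntzRep.star_matrixMap (t : P)
    (T : EuclideanSpace ℂ (Fin (d t)) →L[ℂ] EuclideanSpace ℂ (Fin (d t))) :
    star (φ.matrixMap t T) = φ.matrixMap t (star T) := by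
  -- `unit` need not be an identity of `B`; once it is known to act trivially here, it can be
  -- expanded over the basis.
  have h : star (φ.matrixMap t T) = star (φ.matrixMap t T) * φ.unit := by
    rw [matrixMap, star_sum, Finset.sum_mul]
    refine Finset.sum_congr rfl fun j _ => ?_
    rw [StarMul.star_mul, _root_.mul_assoc]
    conv_rhs => rw [← φ.star_unit, ← StarMul.star_mul, unit_mul_vec]
  rw [h, ← φ.sum_vec_mul_star t (EuclideanSpace.basisFun (Fin (d t)) ℂ), Finset.mul_sum]
  refine Finset.sum_congr rfl fun k _ => ?_
  rw [← _root_.mul_assoc]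
  congr 1
  rw [matrixMap, star_sum, Finset.sum_mul,
    ← (EuclideanSpace.basisFun (Fin (d t)) ℂ).sum_repr' (star T _), map_sum]
  refine Finset.sum_congr rfl fun j _ => ?_
  rw [StarMul.star_mul, star_star, _root_.mul_assoc, star_vec_mul_vec, mul_smul_comm,
    vec_mul_unit, _root_.map_smul, ContinuousLinearMap.star_eq_adjoint,
    ContinuousLinearMap.adjoint_inner_right]

/-- The ⋆-homomorphism from the operators on the fiber over `t` whose range is spanned by the
products `v w*` with `v`, `w` in the image of that fiber. -/
def CuntzRep.matrixHom (t : P) :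
    (EuclideanSpace ℂ (Fin (d t)) →L[ℂ] EuclideanSpace ℂ (Fin (d t))) →⋆ₙₐ[ℂ] B where
  toFun := φ.matrixMap t
  map_smul' c T := by
    simp [matrixMap, Finset.smul_sum, smul_mul_assoc]
  map_zero' := by simp [matrixMap]
  map_add' T S := by
    simp [matrixMap, add_mul, Finset.sum_add_distrib]
  map_mul' := φ.matrixMap_mul t
  map_star' T := (φ.star_matrixMap t T).symm

lemma CuntzRep.matrixHom_mul_vec (t : P)
    (T : EuclideanSpace ℂ (Fin (d t)) →L[ℂ] EuclideanSpace ℂ (Fin (d t)))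
    (x : EuclideanSpace ℂ (Fin (d t))) : φ.matrixHom t T * φ.vec t x = φ.vec t (T x) :=
  φ.matrixMap_mul_vec t T x

lemma CuntzRep.matrixHom_rankOne (t : P) (j k : Fin (d t)) :
    φ.matrixHom t (InnerProductSpace.rankOne ℂ (EuclideanSpace.single j (1 : ℂ))
      (EuclideanSpace.single k (1 : ℂ))) = φ.gen t j * star (φ.gen t k) := by
  change φ.matrixMap t _ = _
  rw [matrixMap, Finset.sum_eq_single k]
  · simp [gen_fin]
  · intro i _ hi
    rw [EuclideanSpace.basisFun_apply, InnerProductSpace.rankOne_apply,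
      EuclideanSpace.inner_single_left]
    simp [hi.symm]
  · simp

/-- The norm of a scalar is at most its distance to a proper closed ideal. -/
lemma CuntzRep.norm_le_norm_smul_unit_sub (I : TwoSidedIdeal B) (hI : IsClosed (I : Set B))
    (h1 : φ.unit ∉ I) (c : ℂ) {b : B} (hb : b ∈ I) : ‖c‖ ≤ ‖c • φ.unit - b‖ := by
  have hu : φ.unit * φ.unit = φ.unit := φ.one_mul_map _
  by_contra! hlt
  have hc : 0 < ‖c‖ := (norm_nonneg _).trans_lt hlt
  have hc0 : c ≠ 0 := norm_pos_iff.mp hc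
  refine h1 (hI.closure_subset (Metric.mem_closure_iff.mpr fun ε hε => ?_))
  let q : ℝ := ‖c‖⁻¹ * ‖c • φ.unit - b‖
  have hq0 : 0 ≤ q := by positivity
  have hq1 : q < 1 := by
    rw [inv_mul_lt_iff₀ hc]
    simpa using hlt
  have hb' : (c⁻¹ • φ.unit) * b ∈ I := I.mul_mem_left _ _ hb
  have hq : ‖φ.unit - (c⁻¹ • φ.unit) * b‖ ≤ q := by
    have h2 : φ.unit - (c⁻¹ • φ.unit) * b = (c⁻¹ • φ.unit) * (c • φ.unit - b) := by
      rw [mul_sub, smul_mul_smul_comm, hu, inv_mul_cancel₀ hc0, one_smul]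
    rw [h2]
    refine (norm_mul_le _ _).trans (mul_le_mul_of_nonneg_right ?_ (norm_nonneg _))
    rw [norm_smul, norm_inv]
    exact mul_le_of_le_one_right (by positivity)
      ((φ.norm_le _).trans_eq (lexProductSystem d).norm_one)
  -- Modulo `I` nothing changes when `unit` is replaced by the powers of `unit - c⁻¹ b`. These tend
  -- to zero, which puts `unit` into the closure of `I`.
  have hpow : ∀ n : ℕ, ∃ i ∈ I, ‖φ.unit - i‖ ≤ q ^ n := by
    intro n
    induction n with
    | zero =>
      refine ⟨0, I.zero_mem, ?_⟩
      rw [sub_zero, pow_zero]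
      exact (φ.norm_le _).trans_eq (lexProductSystem d).norm_one
    | succ n ih =>
      obtain ⟨i, hi, hin⟩ := ih
      set k := (c⁻¹ • φ.unit) * b
      refine ⟨φ.unit * k + i * φ.unit - i * k, I.sub_mem
        (I.add_mem (I.mul_mem_left _ _ hb') (I.mul_mem_right _ _ hi))
        (I.mul_mem_left _ _ hb'), ?_⟩
      have h2 : φ.unit - (φ.unit * k + i * φ.unit - i * k) = (φ.unit - i) * (φ.unit - k) := by
        rw [sub_mul, mul_sub, mul_sub, hu]
        abel
      rw [h2, pow_succ]
      exact (norm_mul_le _ _).trans (mul_le_mul hin hq (norm_nonneg _) (by positivity))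
  obtain ⟨n, hn⟩ := exists_pow_lt_of_lt_one hε hq1
  obtain ⟨i, hi, hin⟩ := hpow n
  exact ⟨i, hi, by rw [dist_eq_norm]; exact hin.trans_lt hn⟩

end Matrix

section

variable {P : Type u} [CommMonoid P] {d : P →ₙ* ℕ+} {B : Type w} [NonUnitalCStarAlgebra B]
  (φ : CuntzRep (lexProductSystem d) B)

lemma CuntzRep.exists_matrixHom_eq {t : P} {y : B} (hy : y ∈ φ.fracSpan t t) :
    ∃ T, φ.matrixHom t T = y := by
  refine Submodule.span_induction (p := fun y _ => ∃ T, φ.matrixHom t T = y) ?_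
    ⟨0, map_zero _⟩ ?_ ?_ hy
  · rintro _ ⟨j, k, rfl⟩
    rcases lt_or_ge j (d t : ℕ) with hj | hj
    · rcases lt_or_ge k (d t : ℕ) with hk | hk
      · exact ⟨_, φ.matrixHom_rankOne t ⟨j, hj⟩ ⟨k, hk⟩⟩
      · exact ⟨0, by simp [φ.gen_of_le hk]⟩
    · exact ⟨0, by simp [φ.gen_of_le hj]⟩
  · rintro _ _ _ _ ⟨T, rfl⟩ ⟨S, rfl⟩
    exact ⟨T + S, _root_.map_add _ _ _⟩
  · rintro c _ _ ⟨T, rfl⟩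
    exact ⟨c • T, _root_.map_smul _ _ _⟩

/-- The norm of an element of the matrix algebra over `t` is at most its distance to a proper
closed ideal. -/
lemma CuntzRep.norm_le_of_mem_ideal (I : TwoSidedIdeal B) (hI : IsClosed (I : Set B))
    (h1 : φ.unit ∉ I) {t : P} {y b : B} (hy : y ∈ φ.fracSpan t t) (hb : b ∈ I) :
    ‖y‖ ≤ ‖y - b‖ := by
  obtain ⟨T, rfl⟩ := φ.exists_matrixHom_eq hy
  refine (NonUnitalStarAlgHom.norm_apply_le (φ.matrixHom t) T).trans ?_
  refine T.opNorm_le_bound (norm_nonneg _) fun x => ?_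
  -- Compressing `y - b` by the vectors `T x` and `x` reduces the claim to scalars: `y` becomes `‖T
  -- x‖²` times the unit, and `b` remains in `I`.
  have h2 := φ.norm_le_norm_smul_unit_sub I hI h1 ⟪T x, T x⟫_ℂ
    (I.mul_mem_left (star (φ.vec t (T x))) _ (I.mul_mem_right _ (φ.vec t x) hb))
  have h3 : ⟪T x, T x⟫_ℂ • φ.unit - star (φ.vec t (T x)) * (b * φ.vec t x)
      = star (φ.vec t (T x)) * ((φ.matrixHom t T - b) * φ.vec t x) := by
    rw [sub_mul, matrixHom_mul_vec, mul_sub, star_vec_mul_vec]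
  rw [h3, inner_self_eq_norm_sq_to_K] at h2
  have h4 : ‖T x‖ ^ 2 ≤ ‖T x‖ * (‖φ.matrixHom t T - b‖ * ‖x‖) := by
    calc ‖T x‖ ^ 2 = ‖((‖T x‖ : ℂ)) ^ 2‖ := by simp
      _ ≤ _ := h2
      _ ≤ ‖star (φ.vec t (T x))‖ * (‖φ.matrixHom t T - b‖ * ‖φ.vec t x‖) :=
        (norm_mul_le _ _).trans (mul_le_mul_of_nonneg_left (norm_mul_le _ _) (norm_nonneg _))
      _ ≤ _ := by
        rw [norm_star]
        gcongr
        · exact φ.norm_vec_le _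
        · exact φ.norm_vec_le _
  rcases (norm_nonneg (T x)).eq_or_lt with h0 | h0
  · rw [← h0]
    positivity
  · rw [sq] at h4
    exact le_of_mul_le_mul_left h4 h0

end

/-! ### Gauge endomorphisms -/

section Gauge

variable {P : Type u} [Monoid P] {E : ProductSystem.{u, v} P}

/-- The Cuntz representation `φ` multiplied by the character `z`. -/
def CuntzRep.twist {B : Type w} [NonUnitalCStarAlgebra B] (φ : CuntzRep E B) (z : P →* Circle) :
    CuntzRep E B where
  toFun {s} x := (z s : ℂ) • φ.toFun x
  map_mul {s t} x y := by
    rw [φ.map_mul, _root_.map_mul, smul_mul_smul_comm, Circle.coe_mul]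
  star_mul {s} x y := by
    have hz : star (z s : ℂ) * (z s : ℂ) = 1 := by
      rw [RCLike.star_def, Complex.conj_mul', Circle.norm_coe]
      simp
    rw [star_smul, smul_mul_smul_comm, φ.star_mul, _root_.map_one, Circle.coe_one, one_smul, hz,
      one_smul]
  sum_mul_star s n b := by
    have hz : (z s : ℂ) * star (z s : ℂ) = 1 := by
      rw [RCLike.star_def, Complex.mul_conj', Circle.norm_coe]
      simp
    rw [_root_.map_one, Circle.coe_one, one_smul, ← φ.sum_mul_star s n b]
    refine Finset.sum_congr rfl fun i _ => ?_
    rw [star_smul, smul_mul_smul_comm, hz, one_smul]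

/-- The target of the Cuntz representation `φ` carries the gauge endomorphisms `φ(x) ↦ z(s) φ(x)`,
for the characters `z` of `P`. -/
def CuntzRep.HasGauge {B : Type w} [NonUnitalCStarAlgebra B] (φ : CuntzRep E B) : Prop :=
  ∀ z : P →* Circle, ∃ γ : B →⋆ₙₐ[ℂ] B,
    ∀ (s : P) (x : E.fiber s), γ (φ.toFun x) = (z s : ℂ) • φ.toFun x

lemma CuntzAlgebra.hasGauge [Countable P] : (CuntzAlgebra.rep E).HasGauge := fun z =>
  (CuntzAlgebra.existsUnique_lift ((CuntzAlgebra.rep E).twist z)).exists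

/-- The endomorphism of the inverse character is a left inverse, and both are contractive. -/
lemma CuntzRep.norm_gauge {B : Type w} [NonUnitalCStarAlgebra B] (φ : CuntzRep E B)
    (hφ : φ.cstar = ⊤) (hg : φ.HasGauge) {z : P →* Circle} {γ : B →⋆ₙₐ[ℂ] B}
    (hγ : ∀ (s : P) (x : E.fiber s), γ (φ.toFun x) = (z s : ℂ) • φ.toFun x) (a : B) :
    ‖γ a‖ = ‖a‖ := by
  obtain ⟨γ', hγ'⟩ := hg z⁻¹
  have h : γ'.comp γ = NonUnitalStarAlgHom.id ℂ B := by
    refine φ.cstar_hom_ext hφ _ _ fun s x => ?_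
    rw [NonUnitalStarAlgHom.comp_apply, hγ, _root_.map_smul, hγ', smul_smul,
      ← Circle.coe_mul, MonoidHom.inv_apply, mul_inv_cancel, Circle.coe_one, one_smul]
    rfl
  refine le_antisymm (NonUnitalStarAlgHom.norm_apply_le _ _) ?_
  calc ‖a‖ = ‖γ' (γ a)‖ := congrArg norm (DFunLike.congr_fun h a).symm
    _ ≤ ‖γ a‖ := NonUnitalStarAlgHom.norm_apply_le _ _

end Gauge

end ProductSystem

/-! ### Averages along gauge orbits -/

/-- A family of positive elements of equal norm and with finitely many values up to small error has
sums that grow linearly. -/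
lemma mul_le_card_mul_norm_sum {B : Type w} [NonUnitalCStarAlgebra B] {b : ℕ → B} {c : ℝ}
    (hc : 0 < c) (hb : ∀ n, ‖star (b n) * b n‖ = c) (F : Finset B)
    (hF : ∀ n, ∃ x ∈ F, ‖star (b n) * b n - x‖ < c / 4) (N : ℕ) :
    N * c ≤ 2 * F.card * ‖∑ n ∈ Finset.range N, star (b n) * b n‖ := by
  classical
  let _ : PartialOrder B := CStarAlgebra.spectralOrder B
  have _ : StarOrderedRing B := CStarAlgebra.spectralOrderedRing B
  choose f hfF hf using hF
  have hFne : F.Nonempty := ⟨f 0, hfF 0⟩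
  have hF0 : (0 : ℝ) < F.card := by exact_mod_cast hFne.card_pos
  -- Pigeonhole: at least `N / F.card` of the terms lie near the same `x`.
  obtain ⟨x, hx, hR⟩ := Finset.exists_le_card_fiber_of_nsmul_le_card_of_maps_to
    (s := Finset.range N) (t := F) (f := f) (b := (N : ℝ) / F.card) (fun n _ => hfF n) hFne (by
      rw [nsmul_eq_mul, mul_div_cancel₀ _ hF0.ne', Finset.card_range])
  set R := (Finset.range N).filter fun n => f n = x
  -- By positivity, discarding the other terms does not increase the norm.
  have h1 : ‖∑ n ∈ R, star (b n) * b n‖ ≤ ‖∑ n ∈ Finset.range N, star (b n) * b n‖ :=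
    CStarAlgebra.norm_le_norm_of_nonneg_of_le
      (Finset.sum_nonneg fun n _ => star_mul_self_nonneg (b n))
      (Finset.sum_le_sum_of_subset_of_nonneg (Finset.filter_subset _ _)
        fun n _ _ => star_mul_self_nonneg (b n))
  -- As `‖x‖ ≥ 3c/4` and each retained term is within `c/4` of `x`, no cancellation brings their sum
  -- below `R.card * c/2`.
  have h2 : (R.card : ℝ) * (c / 2) ≤ ‖∑ n ∈ R, star (b n) * b n‖ := by
    rcases R.eq_empty_or_nonempty with h | ⟨m, hm⟩
    · simp [h]
    · have hxn : c - c / 4 ≤ ‖x‖ := by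
        have h3 := hf m
        rw [(Finset.mem_filter.mp hm).2] at h3
        have h4 := norm_sub_norm_le (star (b m) * b m) x
        rw [hb] at h4
        linarith
      have h5 : ‖∑ n ∈ R, (star (b n) * b n - x)‖ ≤ R.card * (c / 4) := by
        rw [← nsmul_eq_mul, ← Finset.sum_const]
        refine norm_sum_le_of_le _ fun n hn => ?_
        have h3 := hf n
        rw [(Finset.mem_filter.mp hn).2] at h3
        exact h3.le
      rw [Finset.sum_sub_distrib, Finset.sum_const] at h5
      have h6 := norm_sub_norm_le (R.card • x) (∑ n ∈ R, star (b n) * b n)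
      rw [norm_sub_rev, ← Nat.cast_smul_eq_nsmul ℂ, norm_smul, RCLike.norm_natCast] at h6
      rw [← Nat.cast_smul_eq_nsmul ℂ] at h5
      nlinarith [Nat.cast_nonneg (α := ℝ) R.card]
  rw [div_le_iff₀ hF0] at hR
  nlinarith

lemma norm_sum_pow_smul_le {B : Type w} [NormedAddCommGroup B] [NormedSpace ℂ B] {ζ : ℂ}
    (hζ : ‖ζ‖ = 1) (h1 : ζ ≠ 1) (y : B) (N : ℕ) :
    ‖∑ n ∈ Finset.range N, ζ ^ n • y‖ ≤ 2 / ‖ζ - 1‖ * ‖y‖ := by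
  rw [← Finset.sum_smul, norm_smul, geom_sum_eq h1, norm_div]
  gcongr
  refine (norm_sub_le _ _).trans ?_
  rw [norm_pow, hζ, one_pow, NormOneClass.norm_one]
  norm_num

/-- A real number `τ` such that `n ↦ n ^ (i τ)` is injective on the positive integers. -/
lemma exists_circle_exp_injective :
    ∃ τ : ℝ, Function.Injective fun n : ℕ+ => Circle.exp (τ * Real.log (n : ℕ)) := by
  -- The exceptional `τ` satisfy `τ (log n - log m) ∈ 2πℤ` for some `n ≠ m`, so they are countably
  -- many. The pairs `n = m` only add the harmless value `0`, by division by zero.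
  have hc : (⋃ q : ℕ+ × ℕ+ × ℤ, ({(q.2.2 * (2 * Real.pi)) /
      (Real.log (q.1 : ℕ) - Real.log (q.2.1 : ℕ))} : Set ℝ)).Countable :=
    Set.countable_iUnion fun _ => Set.countable_singleton _
  obtain ⟨τ, hτ⟩ : ∃ τ, τ ∉ ⋃ q : ℕ+ × ℕ+ × ℤ, ({(q.2.2 * (2 * Real.pi)) /
      (Real.log (q.1 : ℕ) - Real.log (q.2.1 : ℕ))} : Set ℝ) := by
    by_contra! h
    exact Set.not_countable_univ (α := ℝ) ((Set.eq_univ_of_forall h) ▸ hc)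
  refine ⟨τ, fun n m hnm => ?_⟩
  by_contra hne
  have hlog : Real.log (n : ℕ) - Real.log (m : ℕ) ≠ 0 := by
    intro h
    have h2 := Real.log_injOn_pos (Set.mem_Ioi.mpr (by exact_mod_cast n.pos))
      (Set.mem_Ioi.mpr (by exact_mod_cast m.pos)) (sub_eq_zero.mp h)
    exact hne (PNat.eq (by exact_mod_cast h2))
  have h1 : Circle.exp (τ * (Real.log (n : ℕ) - Real.log (m : ℕ))) = 1 := by
    rw [mul_sub, Circle.exp_sub, div_eq_one]
    exact hnm
  obtain ⟨k, hk⟩ := Circle.exp_eq_one.mp h1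
  refine hτ (Set.mem_iUnion.mpr ⟨(n, m, k), ?_⟩)
  rw [Set.mem_singleton_iff, eq_div_iff hlog]
  exact hk

/-- The character is `s ↦ d(s) ^ (i τ)`. Injectivity gives `z s / z t ≠ 1` for `s ≠ t`, so the
powers of this single character detect every nonzero degree, and integration over a dual group is
not needed. -/
lemma exists_injective_character {P : Type u} [Monoid P] {d : P →ₙ* ℕ+}
    (hd : Function.Injective d) : ∃ z : P →* Circle, Function.Injective z := by
  obtain ⟨τ, hτ⟩ := exists_circle_exp_injective
  refine ⟨{ toFun := fun s => Circle.exp (τ * Real.log (d s : ℕ))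
            map_one' := by rw [lex_card_one]; simp
            map_mul' := fun s t => ?_ }, hτ.comp hd⟩
  have h : ∀ s, ((d s : ℕ) : ℝ) ≠ 0 := fun s => by exact_mod_cast (d s).pos.ne'
  rw [lex_card_mul, Nat.cast_mul, Real.log_mul (h s) (h t), mul_add, Circle.exp_add]

/-! ### Proper closed ideals vanish when `d` is injective -/

namespace ProductSystem

variable {P : Type u} [CommMonoid P] {d : P →ₙ* ℕ+} {B : Type w} [NonUnitalCStarAlgebra B]
  (φ : CuntzRep (lexProductSystem d) B) {z : P →* Circle} {γ : ℕ → B →⋆ₙₐ[ℂ] B}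

lemma CuntzRep.gauge_gen
    (hγ : ∀ n (s : P) (x : EuclideanSpace ℂ (Fin (d s))),
      γ n (φ.vec s x) = ((z ^ n) s : ℂ) • φ.vec s x) (n : ℕ) (s : P) (j : ℕ) :
    γ n (φ.gen s j) = (z s : ℂ) ^ n • φ.gen s j := by
  unfold gen
  split_ifs
  · rw [hγ, MonoidHom.pow_apply, Circle.coe_pow]
  · simp

lemma CuntzRep.gauge_gen_mul_star_gen
    (hγ : ∀ n (s : P) (x : EuclideanSpace ℂ (Fin (d s))),
      γ n (φ.vec s x) = ((z ^ n) s : ℂ) • φ.vec s x) (n : ℕ) (s t : P) (j k : ℕ) :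
    γ n (φ.gen s j * star (φ.gen t k))
      = ((z s / z t : Circle) : ℂ) ^ n • (φ.gen s j * star (φ.gen t k)) := by
  rw [_root_.map_mul, map_star, φ.gauge_gen hγ, φ.gauge_gen hγ, star_smul, smul_mul_smul_comm,
    div_eq_mul_inv, Circle.coe_mul, mul_pow, Circle.coe_inv_eq_conj, star_pow]
  rfl

lemma CuntzRep.gauge_fracSpan
    (hγ : ∀ n (s : P) (x : EuclideanSpace ℂ (Fin (d s))),
      γ n (φ.vec s x) = ((z ^ n) s : ℂ) • φ.vec s x) (n : ℕ) {s t : P} {y : B}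
    (hy : y ∈ φ.fracSpan s t) : γ n y = ((z s / z t : Circle) : ℂ) ^ n • y := by
  refine Submodule.span_induction (p := fun y _ =>
    γ n y = ((z s / z t : Circle) : ℂ) ^ n • y) ?_ (by simp)
    (fun x y _ _ hx hy => ?_) (fun c x _ hx => ?_) hy
  · rintro _ ⟨j, k, rfl⟩
    exact φ.gauge_gen_mul_star_gen hγ n s t j k
  · rw [_root_.map_add, hx, hy, smul_add]
  · rw [_root_.map_smul, hx, smul_comm]

open scoped Pointwise in
/-- Orbits of the gauge action have finitely many values up to small error. -/
lemma CuntzRep.exists_finset_near_orbit (hφ : φ.cstar = ⊤)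
    (hγ : ∀ n (s : P) (x : EuclideanSpace ℂ (Fin (d s))),
      γ n (φ.vec s x) = ((z ^ n) s : ℂ) • φ.vec s x) (a : B) {ε : ℝ} (hε : 0 < ε) :
    ∃ F : Finset B, ∀ n, ∃ x ∈ F, ‖γ n a - x‖ < ε := by
  obtain ⟨a', ha', haa⟩ := φ.exists_words_near (a := a)
    (hφ ▸ NonUnitalStarAlgebra.mem_top) (half_pos hε)
  -- The orbit of a single word stays in its multiples by the closed unit disc, which are compact;
  -- sums and scalar multiples preserve this.
  obtain ⟨K, hK, hKa⟩ : ∃ K : Set B, IsCompact K ∧ ∀ n, γ n a' ∈ K := by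
    refine φ.words_induction ha' (p := fun a => ∃ K : Set B, IsCompact K ∧ ∀ n, γ n a ∈ K)
      ⟨{0}, isCompact_singleton, fun n => by simp⟩ ?_ ?_ ?_
    · rintro x y ⟨K, hK, hKx⟩ ⟨K', hK', hKy⟩
      exact ⟨K + K', hK.add hK', fun n => by
        rw [_root_.map_add]; exact Set.add_mem_add (hKx n) (hKy n)⟩
    · rintro c x ⟨K, hK, hKx⟩
      exact ⟨c • K, hK.smul c, fun n => by
        rw [_root_.map_smul]; exact Set.smul_mem_smul_set (hKx n)⟩
    · intro s t j k
      refine ⟨(fun c : ℂ => c • (φ.gen s j * star (φ.gen t k))) '' Metric.closedBall 0 1,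
        (isCompact_closedBall _ _).image (by fun_prop), fun n => ?_⟩
      rw [φ.gauge_gen_mul_star_gen hγ]
      refine ⟨_, ?_, rfl⟩
      rw [mem_closedBall_zero_iff, norm_pow, Circle.norm_coe, one_pow]
  obtain ⟨F, -, hF, hKF⟩ := hK.finite_cover_balls (half_pos hε)
  refine ⟨hF.toFinset, fun n => ?_⟩
  obtain ⟨x, hx, hxn⟩ := Set.mem_iUnion₂.mp (hKF (hKa n))
  refine ⟨x, hF.mem_toFinset.mpr hx, ?_⟩
  have h1 : ‖γ n a - γ n a'‖ < ε / 2 := by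
    rw [← map_sub]
    exact (NonUnitalStarAlgHom.norm_apply_le _ _).trans_lt haa
  rw [Metric.mem_ball, dist_eq_norm] at hxn
  calc ‖γ n a - x‖ = ‖(γ n a - γ n a') + (γ n a' - x)‖ := by rw [sub_add_sub_cancel]
    _ ≤ ‖γ n a - γ n a'‖ + ‖γ n a' - x‖ := norm_add_le _ _
    _ < ε := by linarith

/-- The Cesàro means under the gauge action of an element of a proper closed ideal tend to zero. -/
lemma CuntzRep.norm_sum_gauge_le (hd : Function.Injective d) (hφ : φ.cstar = ⊤)
    (hz : Function.Injective z)
    (hγ : ∀ n (s : P) (x : EuclideanSpace ℂ (Fin (d s))),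
      γ n (φ.vec s x) = ((z ^ n) s : ℂ) • φ.vec s x)
    (I : TwoSidedIdeal B) (hI : IsClosed (I : Set B)) (h1 : φ.unit ∉ I) {a : B} (ha : a ∈ I)
    {ε : ℝ} (hε : 0 < ε) :
    ∃ C : ℝ, ∀ N : ℕ, ‖∑ n ∈ Finset.range N, γ n a‖ ≤ ε * N + C := by
  classical
  obtain ⟨a', ha', haa⟩ := φ.exists_words_near (a := a)
    (hφ ▸ NonUnitalStarAlgebra.mem_top) (half_pos hε)
  obtain ⟨t, ht⟩ := φ.exists_mem_of_mem_words ha'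
  obtain ⟨f, hf, hfa⟩ := (Submodule.mem_iSup_iff_exists_finsupp _ _).mp ht
  have hsum : a' = f t + ∑ s ∈ f.support.erase t, f s := by
    rw [← hfa, Finsupp.sum]
    by_cases h : t ∈ f.support
    · rw [Finset.add_sum_erase _ _ h]
    · rw [Finset.erase_eq_of_notMem h, Finsupp.notMem_support_iff.mp h, zero_add]
  obtain ⟨W, hW1, hW0, hWt⟩ :=
    φ.exists_compressor hd t (f.support.erase t) (Finset.notMem_erase _ _)
  have hWa : star W * a' * W = f t := by
    rw [hsum, mul_add, add_mul, hWt _ (hf t), Finset.mul_sum, Finset.sum_mul,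
      Finset.sum_eq_zero fun s hs => hW0 s hs _ (hf s), add_zero]
  -- `W* a W` lies in `I`, and its distance to `f t = W* a' W` is at most `‖a - a'‖`.
  have hft : ‖f t‖ ≤ ε / 2 := by
    refine (φ.norm_le_of_mem_ideal I hI h1 (hf t)
      (I.mul_mem_right _ W (I.mul_mem_left (star W) _ ha))).trans ?_
    rw [← hWa, ← sub_mul, ← mul_sub]
    calc ‖star W * (a' - a) * W‖ ≤ ‖star W‖ * ‖a' - a‖ * ‖W‖ :=
          (norm_mul_le _ _).trans (mul_le_mul_of_nonneg_right (norm_mul_le _ _) (norm_nonneg _))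
      _ ≤ 1 * ‖a' - a‖ * 1 := by
          rw [norm_star]
          gcongr
      _ ≤ ε / 2 := by
          rw [norm_sub_rev, _root_.one_mul, _root_.mul_one]
          exact haa.le
  -- The terms of nonzero degree contribute geometric sums with ratio `z s / z t ≠ 1`, bounded
  -- independently of `N`.
  refine ⟨∑ s ∈ f.support.erase t, 2 / ‖((z s / z t : Circle) : ℂ) - 1‖ * ‖f s‖, fun N => ?_⟩
  have h2 : ∑ n ∈ Finset.range N, γ n a = (∑ n ∈ Finset.range N, γ n (a - a'))
      + (∑ n ∈ Finset.range N, f t)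
      + ∑ s ∈ f.support.erase t, ∑ n ∈ Finset.range N, ((z s / z t : Circle) : ℂ) ^ n • f s := by
    rw [Finset.sum_comm, ← Finset.sum_add_distrib, ← Finset.sum_add_distrib]
    refine Finset.sum_congr rfl fun n _ => ?_
    have h3 : γ n a' = f t + ∑ s ∈ f.support.erase t, ((z s / z t : Circle) : ℂ) ^ n • f s := by
      conv_lhs => rw [hsum]
      rw [_root_.map_add, map_sum, φ.gauge_fracSpan hγ n (hf t), div_self', Circle.coe_one, one_pow,
        one_smul]
      exact congrArg _ (Finset.sum_congr rfl fun s _ => φ.gauge_fracSpan hγ n (hf s))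
    rw [map_sub, add_assoc, ← h3, sub_add_cancel]
  rw [h2]
  refine (norm_add_le _ _).trans (add_le_add ((norm_add_le _ _).trans ?_) ?_)
  · have h3 : ‖∑ n ∈ Finset.range N, γ n (a - a')‖ ≤ N * (ε / 2) := by
      have := norm_sum_le_of_le (Finset.range N) (f := fun n => γ n (a - a'))
        (n := fun _ => ε / 2) fun n _ => (NonUnitalStarAlgHom.norm_apply_le (γ n) _).trans haa.le
      simpa only [Finset.sum_const, Finset.card_range, nsmul_eq_mul] using this
    have h4 : ‖∑ _n ∈ Finset.range N, f t‖ ≤ N * (ε / 2) := by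
      have := norm_sum_le_of_le (Finset.range N) (f := fun _ => f t)
        (n := fun _ => ε / 2) fun n _ => hft
      simpa only [Finset.sum_const, Finset.card_range, nsmul_eq_mul] using this
    linarith
  · refine (norm_sum_le _ _).trans (Finset.sum_le_sum fun s hs => ?_)
    refine norm_sum_pow_smul_le (Circle.norm_coe _) (fun h => ?_) _ _
    rw [Circle.coe_eq_one, div_eq_one] at h
    exact (Finset.mem_erase.mp hs).1 (hz h)

lemma CuntzRep.unit_mul_of_cstar_eq_top (hφ : φ.cstar = ⊤) (a : B) : φ.unit * a = a := by
  have h1 : ∀ b ∈ φ.words, φ.unit * b = b := fun b hb => by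
    refine φ.words_induction hb (p := fun b => φ.unit * b = b) (by simp) (fun x y hx hy => ?_)
      (fun c x hx => ?_) fun s t j k => ?_
    · rw [mul_add, hx, hy]
    · rw [mul_smul_comm, hx]
    · rw [← _root_.mul_assoc, unit_mul_gen]
  have hcl : IsClosed {b : B | φ.unit * b = b} := isClosed_eq (by fun_prop) continuous_id
  refine hcl.closure_subset (Metric.mem_closure_iff.mpr fun ε hε => ?_)
  obtain ⟨b, hb, hab⟩ := φ.exists_words_near (a := a) (hφ ▸ NonUnitalStarAlgebra.mem_top) hε
  exact ⟨b, h1 b hb, by rwa [dist_eq_norm]⟩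

/-- If `d` is injective, a C⋆-algebra generated by a Cuntz representation and carrying the gauge
action has no nontrivial closed ideals. -/
theorem CuntzRep.ideal_eq_bot_or_top (hd : Function.Injective d) (hφ : φ.cstar = ⊤)
    (hg : φ.HasGauge) (I : TwoSidedIdeal B) (hI : IsClosed (I : Set B)) : I = ⊥ ∨ I = ⊤ := by
  by_cases h1 : φ.unit ∈ I
  · right
    refine eq_top_iff.mpr fun a _ => ?_
    rw [← φ.unit_mul_of_cstar_eq_top hφ a]
    exact I.mul_mem_right _ _ h1
  left
  refine eq_bot_iff.mpr fun a ha => ?_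
  by_contra hne
  obtain ⟨z, hz⟩ := exists_injective_character hd
  choose γ hγ using fun n : ℕ => hg (z ^ n)
  have hγ' : ∀ n (s : P) (x : EuclideanSpace ℂ (Fin (d s))),
      γ n (φ.vec s x) = ((z ^ n) s : ℂ) • φ.vec s x := fun n s x => hγ n s x
  have ha0 : a ≠ 0 := fun h => hne (h ▸ zero_mem _)
  have hc : 0 < ‖star a * a‖ := by
    rw [norm_pos_iff]
    exact fun h => ha0 ((CStarRing.star_mul_self_eq_zero_iff a).mp h)
  set c := ‖star a * a‖
  have hmul : ∀ n, γ n (star a * a) = star (γ n a) * γ n a := fun n => by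
    rw [_root_.map_mul, map_star]
  obtain ⟨F, hF⟩ := φ.exists_finset_near_orbit hφ hγ' (star a * a) (ε := c / 4) (by positivity)
  have hF0 : (0 : ℝ) < F.card := by
    obtain ⟨x, hx, -⟩ := hF 0
    exact_mod_cast Finset.card_pos.mpr ⟨x, hx⟩
  -- With this `ε` the upper bound grows like `N c / (4 F.card)`, half the rate of the lower bound
  -- `N c / (2 F.card)`. They conflict once `N > 4 F.card C / c`.
  obtain ⟨C, hC⟩ := φ.norm_sum_gauge_le hd hφ hz hγ' I hI h1 (I.mul_mem_left (star a) _ ha)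
    (ε := c / (4 * F.card)) (by positivity)
  obtain ⟨N, hN⟩ := exists_nat_gt (4 * F.card * C / c)
  have h2 : N * c ≤ 2 * F.card * ‖∑ n ∈ Finset.range N, star (γ n a) * γ n a‖ := by
    refine mul_le_card_mul_norm_sum hc (fun n => ?_) F (fun n => ?_) N
    · rw [← hmul]
      exact φ.norm_gauge hφ hg (hγ n) _
    · rw [← hmul]
      exact hF n
  simp only [← hmul] at h2
  have h3 : 2 * F.card * ‖∑ n ∈ Finset.range N, γ n (star a * a)‖
      ≤ 2 * F.card * (c / (4 * F.card) * N + C) := by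
    gcongr
    exact hC N
  have h4 : 2 * (F.card : ℝ) * (c / (4 * F.card) * N + C) = N * c / 2 + 2 * F.card * C := by
    field_simp
    ring
  rw [div_lt_iff₀ hc] at hN
  linarith

end ProductSystem

/-! ### Digit representations on a Hilbert space with basis `[0, 1) × G` -/

section BasisIsometry

variable {ι : Type u} {H : Type v} [NormedAddCommGroup H] [InnerProductSpace ℂ H]
  (b : HilbertBasis ι ℂ H)

/-- The isometry that maps the vectors of a Hilbert basis to other vectors of that basis, along an
injective map of the indices. -/
def HilbertBasis.isometryOfInjective [CompleteSpace H] {σ : ι → ι} (hσ : Function.Injective σ) : H →L[ℂ] H :=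
  ((b.orthonormal.comp σ hσ).orthogonalFamily.linearIsometry.comp
    b.repr.toLinearIsometry).toContinuousLinearMap

lemma HilbertBasis.isometryOfInjective_apply [CompleteSpace H] {σ : ι → ι} (hσ : Function.Injective σ) (i : ι) :
    b.isometryOfInjective hσ (b i) = b (σ i) := by
  classical
  change (b.orthonormal.comp σ hσ).orthogonalFamily.linearIsometry (b.repr (b i)) = _
  rw [b.repr_self, OrthogonalFamily.linearIsometry_apply_single]
  simp

lemma HilbertBasis.continuousLinearMap_ext {T S : H →L[ℂ] H} (h : ∀ i, T (b i) = S (b i)) :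
    T = S := by
  refine ContinuousLinearMap.ext_on (s := Set.range b) ?_ ?_
  · rw [Submodule.dense_iff_topologicalClosure_eq_top]
    exact b.dense_span
  · rintro _ ⟨i, rfl⟩
    exact h i

lemma HilbertBasis.ext_inner {x y : H} (h : ∀ i, ⟪b i, x⟫_ℂ = ⟪b i, y⟫_ℂ) : x = y := by
  refine b.repr.injective (lp.ext (funext fun i => ?_))
  rw [b.repr_apply_apply, b.repr_apply_apply, h]

end BasisIsometry

namespace ProductSystem

section Construction

variable {P : Type u} [Monoid P] (d : P →ₙ* ℕ+)

/-- The Cuntz representation of a lexicographic product system determined by the images of the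
canonical basis vectors. -/
def CuntzRep.ofBasis {B : Type w} [CStarAlgebra B] (V : ∀ s, Fin (d s) → B)
    (hmul : ∀ r s j k, V r j * V s k = V (r * s) (lexIndex d r s (j, k)))
    (hstar : ∀ s j k, star (V s j) * V s k = if j = k then 1 else 0)
    (hsum : ∀ s, ∑ j, V s j * star (V s j) = 1)
    (hone : ∑ j, V 1 j = 1) : CuntzRep (lexProductSystem d) B where
  toFun {s} := fun x : EuclideanSpace ℂ (Fin (d s)) => ∑ j, x j • V s j
  map_mul {r s} x y := by
    have h1 : ∀ (x : EuclideanSpace ℂ (Fin (d r))) (y : EuclideanSpace ℂ (Fin (d s))),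
        ∑ i, lexMul d r s x y i • V (r * s) i = (∑ j, x j • V r j) * ∑ k, y k • V s k := by
      intro x y
      rw [← (lexIndex d r s).sum_comp, Fintype.sum_prod_type, Finset.sum_mul_sum]
      refine Finset.sum_congr rfl fun j _ => Finset.sum_congr rfl fun k _ => ?_
      rw [lexMul_lexIndex, smul_mul_smul_comm, hmul]
    exact h1 x y
  star_mul {s} x y := by
    have h1 : ∑ j, (lexProductSystem d).one.ofLp j • V 1 j = 1 := by
      rw [← hone]
      exact Finset.sum_congr rfl fun j _ => one_smul _ _
    have h2 : ∀ x y : EuclideanSpace ℂ (Fin (d s)),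
        star (∑ j, y j • V s j) * ∑ j, x j • V s j = ⟪y, x⟫_ℂ • (1 : B) := by
      intro x y
      rw [star_sum, Finset.sum_mul_sum, PiLp.inner_apply, Finset.sum_smul]
      refine Finset.sum_congr rfl fun j _ => ?_
      simp only [star_smul, smul_mul_smul_comm, hstar, smul_ite, smul_zero]
      rw [Finset.sum_ite_eq, if_pos (Finset.mem_univ j), RCLike.inner_apply, mul_comm,
        RCLike.star_def]
    exact (h2 x y).trans (congrArg _ h1.symm)
  sum_mul_star s n b := by
    have h1 : ∑ j, (lexProductSystem d).one.ofLp j • V 1 j = 1 := by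
      rw [← hone]
      exact Finset.sum_congr rfl fun j _ => one_smul _ _
    refine Eq.trans ?_ h1.symm
    let c : OrthonormalBasis (Fin n) ℂ (EuclideanSpace ℂ (Fin (d s))) := b
    change ∑ i, (∑ j, c i j • V s j) * star (∑ j, c i j • V s j) = 1
    -- Parseval: the coordinates of an orthonormal basis have orthonormal columns, which reduces the
    -- Cuntz relation for any basis to the canonical one.
    have h2 : ∀ j k, ∑ i, c i j * star (c i k) = if j = k then 1 else 0 := by
      intro j k
      have h := c.sum_inner_mul_inner (EuclideanSpace.single j (1 : ℂ))
        (EuclideanSpace.single k (1 : ℂ))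
      rw [EuclideanSpace.inner_single_left] at h
      rw [show (if j = k then (1 : ℂ) else 0) = (starRingEnd ℂ) 1 * (EuclideanSpace.single k (1 : ℂ)
        : EuclideanSpace ℂ (Fin (d s))) j by simp, ← h]
      refine Finset.sum_congr rfl fun i _ => ?_
      rw [EuclideanSpace.inner_single_left, EuclideanSpace.inner_single_right]
      simp
    calc ∑ i, (∑ j, c i j • V s j) * star (∑ j, c i j • V s j)
        = ∑ i, ∑ j, ∑ k, (c i j * star (c i k)) • (V s j * star (V s k)) := by
          refine Finset.sum_congr rfl fun i _ => ?_
          rw [star_sum, Finset.sum_mul_sum]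
          simp only [star_smul, smul_mul_smul_comm]
      _ = ∑ j, ∑ k, (∑ i, c i j * star (c i k)) • (V s j * star (V s k)) := by
          rw [Finset.sum_comm]
          refine Finset.sum_congr rfl fun j _ => ?_
          rw [Finset.sum_comm]
          simp only [Finset.sum_smul]
      _ = ∑ j, V s j * star (V s j) := by
          simp only [h2, ite_smul, one_smul, zero_smul, Finset.sum_ite_eq, Finset.mem_univ, if_true]
      _ = 1 := hsum s

lemma CuntzRep.ofBasis_gen {B : Type w} [CStarAlgebra B] (V : ∀ s, Fin (d s) → B) (hmul hstar hsum
    hone) (s : P) (j : Fin (d s)) : (CuntzRep.ofBasis d V hmul hstar hsum hone).gen s j = V s j := by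
  rw [gen_fin]
  change ∑ i, (EuclideanSpace.single j (1 : ℂ) : EuclideanSpace ℂ (Fin (d s))) i • V s i = _
  rw [Finset.sum_eq_single j]
  · simp
  · intro i _ hi
    simp [hi]
  · simp

variable {G : Type w} [Group G] (h : P →* G)

/-- The `j`-th of the `d s` affine contractions of `[0, 1)` onto disjoint intervals, together with
the translation by `h s`. -/
def digitMap (s : P) (j : Fin (d s)) (y : Set.Ico (0 : ℝ) 1 × G) : Set.Ico (0 : ℝ) 1 × G :=
  (⟨((y.1 : ℝ) + j) / (d s : ℕ), by
    have h1 := y.1.2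
    have h2 : ((j : ℕ) : ℝ) + 1 ≤ (d s : ℕ) := by exact_mod_cast j.2
    have h3 : (0 : ℝ) ≤ (j : ℕ) := Nat.cast_nonneg _
    refine ⟨div_nonneg (add_nonneg h1.1 h3) (Nat.cast_nonneg _), ?_⟩
    rw [div_lt_one (by linarith)]
    linarith [h1.2]⟩, h s * y.2)

/-- This is `((y + k) / d s + j) / d r = (y + j * d s + k) / (d r * d s)`: lexicographic
multiplication is concatenation of digits in a mixed radix. -/
lemma digitMap_digitMap (r s : P) (j : Fin (d r)) (k : Fin (d s)) (y : Set.Ico (0 : ℝ) 1 × G) :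
    digitMap d h r j (digitMap d h s k y) = digitMap d h (r * s) (lexIndex d r s (j, k)) y := by
  refine Prod.ext (Subtype.ext ?_) ?_
  · have h1 : ((d r : ℕ) : ℝ) ≠ 0 := by exact_mod_cast (d r).pos.ne'
    have h2 : ((d s : ℕ) : ℝ) ≠ 0 := by exact_mod_cast (d s).pos.ne'
    simp only [digitMap]
    rw [lexIndex_val, lex_card_mul]
    push_cast
    field_simp
    ring
  · simp [digitMap, _root_.mul_assoc]

lemma digitMap_injective2 (s : P) : Function.Injective2 (digitMap d h s) := by
  intro j k x y hxy
  have h0 : ((d s : ℕ) : ℝ) ≠ 0 := by exact_mod_cast (d s).pos.ne'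
  have h1 : (x.1 : ℝ) + j = y.1 + k := by
    have := congrArg (fun z : Set.Ico (0 : ℝ) 1 × G => (z.1 : ℝ)) hxy
    simp only [digitMap] at this
    field_simp at this
    exact this
  have h2 : (j : ℕ) = k := by
    have hx := x.1.2
    have hy := y.1.2
    have h3 : ((j : ℕ) : ℝ) < (k : ℕ) + 1 := by linarith [hx.1, hy.2]
    have h4 : ((k : ℕ) : ℝ) < (j : ℕ) + 1 := by linarith [hy.1, hx.2]
    have h5 : (j : ℕ) < k + 1 := by exact_mod_cast h3
    have h6 : (k : ℕ) < j + 1 := by exact_mod_cast h4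
    omega
  refine ⟨Fin.ext h2, Prod.ext (Subtype.ext ?_) ?_⟩
  · rw [h2] at h1
    linarith
  · exact mul_left_cancel (congrArg Prod.snd hxy)

lemma exists_digitMap_eq (s : P) (z : Set.Ico (0 : ℝ) 1 × G) : ∃ j y, digitMap d h s j y = z := by
  have h0 : (0 : ℝ) < (d s : ℕ) := by exact_mod_cast (d s).pos
  have hz := z.1.2
  have h1 : 0 ≤ (z.1 : ℝ) * (d s : ℕ) := mul_nonneg hz.1 h0.le
  have h2 : ⌊(z.1 : ℝ) * (d s : ℕ)⌋₊ < (d s : ℕ) := by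
    rw [Nat.floor_lt h1]
    nlinarith [hz.2]
  -- The digit is the integer part of `z * d s`, and the preimage is its fractional part.
  refine ⟨⟨_, h2⟩, (⟨(z.1 : ℝ) * (d s : ℕ) - ⌊(z.1 : ℝ) * (d s : ℕ)⌋₊, ?_, ?_⟩, (h s)⁻¹ * z.2), ?_⟩
  · exact sub_nonneg.mpr (Nat.floor_le h1)
  · have := Nat.lt_floor_add_one ((z.1 : ℝ) * (d s : ℕ))
    linarith
  · refine Prod.ext (Subtype.ext ?_) ?_
    · simp only [digitMap, sub_add_cancel]
      field_simp
    · simp [digitMap]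

variable {H : Type v} [NormedAddCommGroup H] [InnerProductSpace ℂ H] [CompleteSpace H]
  (b : HilbertBasis (Set.Ico (0 : ℝ) 1 × G) ℂ H)

/-- The isometry induced by `digitMap`. -/
def digitIsometry (s : P) (j : Fin (d s)) : H →L[ℂ] H :=
  b.isometryOfInjective ((digitMap_injective2 d h s).right j)

lemma digitIsometry_apply (s : P) (j : Fin (d s)) (y : Set.Ico (0 : ℝ) 1 × G) :
    digitIsometry d h b s j (b y) = b (digitMap d h s j y) :=
  b.isometryOfInjective_apply _ y

lemma star_digitIsometry_mul (s : P) (j k : Fin (d s)) :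
    star (digitIsometry d h b s j) * digitIsometry d h b s k = if j = k then 1 else 0 := by
  classical
  refine b.continuousLinearMap_ext fun y => b.ext_inner fun x => ?_
  rw [ContinuousLinearMap.star_eq_adjoint, mul_apply_eq_comp,
    ContinuousLinearMap.adjoint_inner_right, digitIsometry_apply, digitIsometry_apply,
    orthonormal_iff_ite.mp b.orthonormal]
  by_cases hjk : j = k
  · subst hjk
    rw [if_pos rfl, one_apply_eq_self, orthonormal_iff_ite.mp b.orthonormal]
    simp only [((digitMap_injective2 d h s).right j).eq_iff]
  · rw [if_neg hjk, if_neg fun h1 => hjk (digitMap_injective2 d h s h1).1]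
    simp

/-- The Cuntz representation of a lexicographic product system on a Hilbert space with an
orthonormal basis indexed by `[0, 1) × G`, by affine maps in the first and translations in the
second coordinate. -/
def digitRep : CuntzRep (lexProductSystem d) (H →L[ℂ] H) :=
  CuntzRep.ofBasis d (digitIsometry d h b)
    (fun r s j k => b.continuousLinearMap_ext fun y => by
      rw [mul_apply_eq_comp, digitIsometry_apply, digitIsometry_apply,
        digitIsometry_apply, digitMap_digitMap])
    (star_digitIsometry_mul d h b)
    (fun s => b.continuousLinearMap_ext fun z => by
      obtain ⟨k, y, rfl⟩ := exists_digitMap_eq d h s z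
      rw [← digitIsometry_apply, _root_.sum_apply, Finset.sum_eq_single k]
      · rw [← mul_apply_eq_comp, _root_.mul_assoc, star_digitIsometry_mul, if_pos rfl]
        simp
      · intro j _ hj
        rw [← mul_apply_eq_comp, _root_.mul_assoc, star_digitIsometry_mul, if_neg hj]
        simp
      · simp)
    (b.continuousLinearMap_ext fun y => by
      have h0 : 0 < (d 1 : ℕ) := (d 1).pos
      have h1 : ∀ j : Fin (d 1), j = ⟨0, h0⟩ := fun j =>
        Fin.ext (by have := j.2; have := lex_card_one d; simp; omega)
      rw [_root_.sum_apply, Finset.sum_eq_single ⟨0, h0⟩ (fun j _ hj => absurd (h1 j) hj)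
        (by simp), digitIsometry_apply, one_apply_eq_self]
      congr 1
      refine Prod.ext (Subtype.ext ?_) ?_
      · simp [digitMap]
      · simp [digitMap])

lemma digitRep_gen_apply (s : P) (j : Fin (d s)) (y : Set.Ico (0 : ℝ) 1 × G) :
    (digitRep d h b).gen s j (b y) = b (digitMap d h s j y) := by
  rw [digitRep, CuntzRep.ofBasis_gen, digitIsometry_apply]

/-- The first generator of every fiber maps basis vectors over `0` to such vectors. -/
lemma digitRep_gen_zero_apply (s : P) (g : G) :
    (digitRep d h b).gen s 0 (b (⟨0, by simp⟩, g)) = b (⟨0, by simp⟩, h s * g) := by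
  have h1 := digitRep_gen_apply d h b s ⟨0, (d s).pos⟩ (⟨0, by simp⟩, g)
  refine h1.trans (congrArg b (Prod.ext (Subtype.ext ?_) rfl))
  simp [digitMap]

lemma digitRep_unit_ne_zero : (digitRep d h b).unit ≠ 0 := by
  intro h0
  have h1 := digitRep_gen_zero_apply d h b 1 1
  rw [CuntzRep.gen_one, h0] at h1
  exact b.orthonormal.ne_zero _ h1.symm

/-- Without translations, `digitMap` depends on `s` only through `d s`, so the representation cannot
distinguish fibers of equal dimension. -/
lemma digitRep_trivial_gen_zero {s t : P} (hst : d s = d t) :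
    (digitRep d (1 : P →* G) b).gen s 0 = (digitRep d (1 : P →* G) b).gen t 0 := by
  refine b.continuousLinearMap_ext fun y => ?_
  refine (digitRep_gen_apply d _ b s ⟨0, (d s).pos⟩ y).trans
    (Eq.trans ?_ (digitRep_gen_apply d _ b t ⟨0, (d t).pos⟩ y).symm)
  simp [digitMap, hst]

end Construction

/-! ### Simplicity forces injectivity, and the equivalence -/

/-- The C⋆-algebra of a Cuntz representation that has enough homomorphisms to the operators on a
Hilbert space is simple only if `d` is injective. -/
lemma injective_of_isSimple {P : Type u} [Monoid P] {d : P →ₙ* ℕ+} {A : Type w}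
    [NonUnitalCStarAlgebra A] (hA : IsSimpleCStarAlgebra A) (ψ : CuntzRep (lexProductSystem d) A)
    {G : Type*} [Group G] {h : P →* G} (hh : Function.Injective h)
    {H : Type*} [NormedAddCommGroup H] [InnerProductSpace ℂ H] [CompleteSpace H]
    (b : HilbertBasis (Set.Ico (0 : ℝ) 1 × G) ℂ H)
    (hlift : ∀ φ : CuntzRep (lexProductSystem d) (H →L[ℂ] H), ∃ π : A →⋆ₙₐ[ℂ] (H →L[ℂ] H),
      ∀ (s : P) (x : (lexProductSystem d).fiber s), π (ψ.toFun x) = φ.toFun x) :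
    Function.Injective d := by
  have hgen : ∀ (φ : CuntzRep (lexProductSystem d) (H →L[ℂ] H)) (π : A →⋆ₙₐ[ℂ] (H →L[ℂ] H)),
      (∀ (s : P) (x : (lexProductSystem d).fiber s), π (ψ.toFun x) = φ.toFun x) →
      ∀ s j, π (ψ.gen s j) = φ.gen s j := by
    intro φ π hπ s j
    unfold CuntzRep.gen
    split_ifs
    · exact hπ s _
    · exact map_zero π
  intro s t hst
  obtain ⟨π, hπ⟩ := hlift (digitRep d 1 b)
  obtain ⟨ρ, hρ⟩ := hlift (digitRep d h b)
  have hcl : IsClosed ((TwoSidedIdeal.ker π : TwoSidedIdeal A) : Set A) := by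
    have hcont : Continuous π := AddMonoidHomClass.continuous_of_bound π 1 fun a => by
      simpa using NonUnitalStarAlgHom.norm_apply_le π a
    have h1 : ((TwoSidedIdeal.ker π : TwoSidedIdeal A) : Set A) = {a | π a = 0} := by
      ext a
      exact TwoSidedIdeal.mem_ker π
    rw [h1]
    exact isClosed_eq hcont continuous_const
  -- If `π` is injective, the coincidence of `gen s 0` and `gen t 0` under `π` already holds in `A`,
  -- and `ρ` carries it to `h s = h t`. The kernel cannot be everything, since `π` does not kill the
  -- unit.
  rcases hA.2 _ hcl with hbot | htop
  · have h1 : ψ.gen s 0 - ψ.gen t 0 ∈ TwoSidedIdeal.ker π := by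
      rw [TwoSidedIdeal.mem_ker, map_sub, hgen _ _ hπ, hgen _ _ hπ,
        digitRep_trivial_gen_zero d b hst, sub_self]
    rw [hbot] at h1
    have h2 : ψ.gen s 0 = ψ.gen t 0 := sub_eq_zero.mp h1
    have h3 := congrArg ρ h2
    rw [hgen _ _ hρ, hgen _ _ hρ] at h3
    have h4 := digitRep_gen_zero_apply d h b s 1
    rw [h3, digitRep_gen_zero_apply] at h4
    have h5 := b.orthonormal.linearIndependent.injective h4
    exact (hh (mul_right_cancel (congrArg Prod.snd h5))).symm
  · have h1 : ψ.unit ∈ TwoSidedIdeal.ker π := htop ▸ trivial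
    rw [TwoSidedIdeal.mem_ker] at h1
    exact absurd ((hπ 1 _).symm.trans h1) (digitRep_unit_ne_zero d 1 b)

end ProductSystem

end

theorem mainTheorem2 {G : Type u} [CommGroup G] [Countable G] (P : Submonoid G)
    (d : P →ₙ* ℕ+) :
    IsSimpleCStarAlgebra (ProductSystem.CuntzAlgebra (lexProductSystem d)) ↔
      Function.Injective d := by
  let b : HilbertBasis (Set.Ico (0 : ℝ) 1 × G) ℂ (lp (fun _ : Set.Ico (0 : ℝ) 1 × G => ℂ) 2) :=
    ⟨LinearIsometryEquiv.refl ℂ _⟩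
  refine ⟨fun hA => ProductSystem.injective_of_isSimple hA
    (ProductSystem.CuntzAlgebra.rep (lexProductSystem d)) (h := P.subtype) Subtype.val_injective b
    fun φ => (ProductSystem.CuntzAlgebra.existsUnique_lift φ).exists, fun hd => ⟨?_, ?_⟩⟩
  -- The algebra is nonzero because the digit representation sends its unit to a nonzero operator.
  · obtain ⟨π, hπ, -⟩ := ProductSystem.CuntzAlgebra.existsUnique_lift
      (ProductSystem.digitRep d P.subtype b)
    refine ⟨⟨(ProductSystem.CuntzAlgebra.rep (lexProductSystem d)).unit, 0, fun h0 => ?_⟩⟩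
    refine ProductSystem.digitRep_unit_ne_zero d P.subtype b ((hπ 1 _).symm.trans ?_)
    exact (congrArg π h0).trans (map_zero π)
  · exact (ProductSystem.CuntzAlgebra.rep (lexProductSystem d)).ideal_eq_bot_or_top hd
      (ProductSystem.CuntzAlgebra.cstar_eq_top _)
      ProductSystem.CuntzAlgebra.hasGauge
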